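/- Let $\mathcal{A}$ and $\mathcal{B}$ be abelian categories, and let $F:\mathcal{A}\to\mathcal{B}$ be a faithful additive functor with a left adjoint $L$ and a right adjoint $R$ (so $F$ is exact). Call an object of $\mathcal{A}$ *$F$-projective* (resp. *$F$-injective*) if it is a direct summand of $LY$ (resp. of $RY$) for some $Y\in\mathcal{B}$, and suppose that the classes of $F$-projective and $F$-injective objects coincide. The *$F$-stable category* $\underline{\mathcal{A}}_F$ has the objects of $\mathcal{A}$, and its morphisms are those of $\mathcal{A}$ modulo the morphisms that factor through an $F$-projective object. Its suspension is the functor $\Omega_F^{-1}$ induced by $X\mapsto\operatorname{coker}(\eta_X:X\to RFX)$, where $\eta$ is the unit of $F\dashv R$. Its distinguished triangles are those isomorphic to $X\xrightarrow{f}Y\xrightarrow{g}Z\xrightarrow{w}\Omega_F^{-1}X$, where $0\to X\xrightarrow{f}Y\xrightarrow{g}Z\to 0$ is a short exact sequence in $\mathcal{A}$ that splits after applying $F$, and $w$ is induced by an extension of $\eta_X$ to a morphism $Y\to RFX$. This makes $\underline{\mathcal{A}}_F$ a triangulated category. A cochain complex $X$ over $\mathcal{A}$ is *$F$-split acyclic*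 if $FX$ is contractible. Let $D_F(\mathcal{A})$ be the Verdier quotient of the homotopy category $\mathrm{K}(\mathcal{A})$ of unbounded cochain complexes by the $F$-split acyclic complexes. Let $D^b_F(\mathcal{A})$ be the full triangulated subcategory of $D_F(\mathcal{A})$ on the objects isomorphic to complexes $X$ such that $FX$ is split exact in all sufficiently high and all sufficiently low degrees. (A complex $K$ is split exact in degree $n$ if $1_{K^n}=d^{n-1}s+s'd^n$ for some $s:K^n\to K^{n-1}$ and $s':K^{n+1}\to K^n$.) Let $K(\mathcal{P})$ be the full subcategory of $D^b_F(\mathcal{A})$ on the objects isomorphic to complexes of $F$-projective objects with only finitely many nonzero terms. Then $K(\mathcal{P})$ is a thick triangulated subcategory of $D^b_F(\mathcal{A})$ (in particular, closed under direct summands), and the inclusion of $\mathcal{A}$ as complexes concentrated in degree zero induces an equivalence of triangulated categories \[ S:\underline{\mathcal{A}}_F\longrightarrow D^b_F(\mathcal{A})/K(\mathcal{P}). \] -/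

import Mathlib

open CategoryTheory Category Limits Preadditive Pretriangulated ZeroObject
open CochainComplex hiding shiftFunctor

universe v₁ v₂ u₁ u₂

noncomputable section

namespace RelativeStable

/-! ### Split exactness of a complex in a given degree -/

section SplitExact

variable {B : Type u₂} [Category.{v₂} B] [Abelian B]

/-- The complex `K` is split exact in degree `n`: the identity of `Kⁿ` is `s d + d s'`
for some `s : Kⁿ ⟶ Kⁿ⁻¹` and `s' : Kⁿ⁺¹ ⟶ Kⁿ`. -/
def IsSplitExactAt (K : CochainComplex B ℤ) (n : ℤ) : Prop :=
  ∃ (s : K.X n ⟶ K.X (n - 1)) (s' : K.X (n + 1) ⟶ K.X n),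
    s ≫ K.d (n - 1) n + K.d n (n + 1) ≫ s' = 𝟙 (K.X n)

lemma isSplitExactAt_iff (K : CochainComplex B ℤ) (i n j : ℤ) (hi : i + 1 = n) (hj : n + 1 = j) :
    IsSplitExactAt K n ↔ ∃ (s : K.X n ⟶ K.X i) (s' : K.X j ⟶ K.X n),
      s ≫ K.d i n + K.d n j ≫ s' = 𝟙 (K.X n) := by
  obtain rfl : i = n - 1 := by lia
  obtain rfl : j = n + 1 := by lia
  rfl

/-- Split exactness in degree `n` is invariant under homotopy equivalences. -/
lemma IsSplitExactAt.of_homotopy {K L : CochainComplex B ℤ} {n : ℤ} (hK : IsSplitExactAt K n)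
    (f : L ⟶ K) (g : K ⟶ L) (h : Homotopy (f ≫ g) (𝟙 L)) : IsSplitExactAt L n := by
  obtain ⟨s, s', hs⟩ := hK
  have h1 := h.comm n
  rw [dNext_eq h.hom (show (ComplexShape.up ℤ).Rel n (n + 1) by simp),
    prevD_eq h.hom (show (ComplexShape.up ℤ).Rel (n - 1) n by simp)] at h1
  have h2 : f.f n ≫ (s ≫ K.d (n - 1) n + K.d n (n + 1) ≫ s') ≫ g.f n = f.f n ≫ g.f n := by
    rw [hs, id_comp]
  refine ⟨f.f n ≫ s ≫ g.f (n - 1) - h.hom n (n - 1), f.f (n + 1) ≫ s' ≫ g.f n - h.hom (n + 1) n, ?_⟩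
  have h3 : f.f n ≫ g.f n - L.d n (n + 1) ≫ h.hom (n + 1) n - h.hom n (n - 1) ≫ L.d (n - 1) n =
      𝟙 (L.X n) := by
    simp only [HomologicalComplex.comp_f, HomologicalComplex.id_f] at h1
    rw [h1]
    abel
  rw [← h3, ← h2]
  simp only [add_comp, comp_add, assoc, sub_comp, comp_sub, HomologicalComplex.Hom.comm,
    HomologicalComplex.Hom.comm_assoc]
  abel

lemma IsSplitExactAt.shift {K : CochainComplex B ℤ} {n : ℤ} (a m : ℤ) (hm : m + a = n)
    (hK : IsSplitExactAt K n) : IsSplitExactAt (K⟦a⟧) m := by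
  subst hm
  obtain ⟨s, s', hs⟩ := (isSplitExactAt_iff K (m - 1 + a) (m + a) (m + 1 + a)
    (by lia) (by lia)).1 hK
  refine ⟨a.negOnePow • s, a.negOnePow • s', ?_⟩
  simpa [smul_smul] using! hs

/-- The mapping cone of a morphism between complexes that are split exact in the relevant
degrees is split exact. -/
lemma IsSplitExactAt.mappingCone {K L : CochainComplex B ℤ} (φ : K ⟶ L) {n : ℤ}
    (hK : IsSplitExactAt K (n + 1)) (hL : IsSplitExactAt L n) :
    IsSplitExactAt (mappingCone φ) n := by
  obtain ⟨s, s', hs⟩ := (isSplitExactAt_iff K n (n + 1) (n + 2) (by lia) (by lia)).1 hK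
  obtain ⟨t, t', ht⟩ := hL
  refine ⟨-((mappingCone.fst φ).1.v n (n + 1) rfl ≫ s ≫
        (mappingCone.inl φ).v n (n - 1) (by lia)) +
      ((mappingCone.snd φ).v n n (add_zero n) ≫ t +
        (mappingCone.fst φ).1.v n (n + 1) rfl ≫ s ≫ φ.f n ≫ t) ≫
          (mappingCone.inr φ).f (n - 1),
    -((mappingCone.fst φ).1.v (n + 1) (n + 2) (by lia) ≫ s' ≫
        (mappingCone.inl φ).v (n + 1) n (by lia)) +
      ((mappingCone.snd φ).v (n + 1) (n + 1) (add_zero _) ≫ t' +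
        (mappingCone.fst φ).1.v (n + 1) (n + 2) (by lia) ≫ s' ≫ φ.f (n + 1) ≫ t') ≫
          (mappingCone.inr φ).f n, ?_⟩
  have h1 := mappingCone.inl_v_d φ n (n - 1) (n + 1) (by lia) (by lia)
  have h2 := mappingCone.d_fst_v φ n (n + 1) (n + 2) rfl (by lia)
  have h3 := mappingCone.d_snd_v φ n (n + 1) rfl
  have h4 := mappingCone.id_X φ n (n + 1) rfl
  have e1 : s ≫ K.d n (n + 1) = 𝟙 _ - K.d (n + 1) (n + 2) ≫ s' := by rw [← hs]; abel
  have e2 : t ≫ L.d (n - 1) n = 𝟙 _ - L.d n (n + 1) ≫ t' := by rw [← ht]; abel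
  rw [← h4]
  simp only [add_comp, comp_add, assoc, sub_comp, comp_sub, neg_comp, comp_neg, id_comp, h1,
    reassoc_of% h2, reassoc_of% h3, reassoc_of% e1, reassoc_of% e2,
    HomologicalComplex.Hom.comm, HomologicalComplex.Hom.comm_assoc]
  abel

end SplitExact

/-! ### Triangulated subcategories of homotopy categories and of localizations -/

section General

variable {A : Type u₁} [Category.{v₁} A] [Abelian A]

/-- A shift-stable property of objects of the homotopy category that is stable under mapping
cones defines a triangulated subcategory. -/
lemma isTriangulated_of_mappingCone (P : ObjectProperty (HomotopyCategory A (ComplexShape.up ℤ)))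
    [P.IsClosedUnderIsomorphisms] [P.ContainsZero]
    (hs : ∀ (K : CochainComplex A ℤ) (n : ℤ), P ((HomotopyCategory.quotient A _).obj K) →
      P ((HomotopyCategory.quotient A _).obj (K⟦n⟧)))
    (hc : ∀ (K L : CochainComplex A ℤ) (φ : K ⟶ L), P ((HomotopyCategory.quotient A _).obj K) →
      P ((HomotopyCategory.quotient A _).obj L) →
      P ((HomotopyCategory.quotient A _).obj (mappingCone φ))) : P.IsTriangulated := by
  have h1 : P.IsStableUnderShift ℤ := ⟨fun n => ⟨fun X hX => by
    obtain ⟨K, rfl⟩ := HomotopyCategory.quotient_obj_surjective X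
    exact P.prop_of_iso (((HomotopyCategory.quotient A (.up ℤ)).commShiftIso n).app K)
      (hs K n hX)⟩⟩
  have h3 : P.IsTriangulatedClosed₃ := .mk' (fun T hT hX hY => by
    obtain ⟨K, hK⟩ := HomotopyCategory.quotient_obj_surjective T.obj₁
    obtain ⟨L, hL⟩ := HomotopyCategory.quotient_obj_surjective T.obj₂
    obtain ⟨X, Y, Z, f, g, h⟩ := T
    dsimp at hK hL hX hY ⊢
    subst hK hL
    obtain ⟨φ, rfl⟩ := (HomotopyCategory.quotient _ _).map_surjective f
    exact P.prop_of_iso (Triangle.π₃.mapIso (exists_iso_of_arrow_iso _ _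
      (HomotopyCategory.mappingCone_triangleh_distinguished φ) hT (Iso.refl _)).choose)
      (hc _ _ φ hX hY))
  have h2 := ObjectProperty.IsTriangulatedClosed₂.of_isTriangulatedClosed₃ (P := P)
  exact { }

/-- The image of a triangulated subcategory under a Verdier localization is a triangulated
subcategory, if the morphisms between its objects are represented by fractions inside it. -/
lemma isTriangulated_map {C : Type*} [Category* C] [HasZeroObject C] [HasShift C ℤ]
    [Preadditive C] [∀ n : ℤ, (shiftFunctor C n).Additive] [Pretriangulated C]
    {D : Type*} [Category* D] [HasZeroObject D] [HasShift D ℤ]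
    [Preadditive D] [∀ n : ℤ, (shiftFunctor D n).Additive] [Pretriangulated D]
    (Q : C ⥤ D) [Q.CommShift ℤ] [Q.IsTriangulated]
    (P : ObjectProperty C) [P.IsTriangulated]
    (h : ∀ ⦃X Y : C⦄ (_ : P X) (_ : P Y) (g : Q.obj X ⟶ Q.obj Y),
      ∃ (X' : C) (_ : P X') (s : X' ⟶ X) (_ : IsIso (Q.map s)) (f : X' ⟶ Y),
        Q.map s ≫ g = Q.map f) : (P.map Q).IsTriangulated where
  isStableUnderShiftBy n := ⟨by
    rintro Y ⟨X, hX, ⟨e⟩⟩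
    exact ⟨X⟦n⟧, P.le_shift n _ hX,
      ⟨(Q.commShiftIso n).app X ≪≫ (shiftFunctor D n).mapIso e⟩⟩⟩
  toIsTriangulatedClosed₂ := .mk' (by
    rintro T hT ⟨X₁, h₁, ⟨e₁⟩⟩ ⟨X₃, h₃, ⟨e₃⟩⟩
    obtain ⟨X', h', s, hs, f, fac⟩ := h h₃ (P.le_shift (1 : ℤ) _ h₁)
      (e₃.hom ≫ T.mor₃ ≫ e₁.inv⟦1⟧' ≫ (Q.commShiftIso (1 : ℤ)).inv.app X₁)
    obtain ⟨X₂, h₂, a, b, H⟩ := P.distinguished_cocone_triangle₂ f h₁ h'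
    refine ⟨X₂, h₂, ⟨Triangle.π₂.mapIso (isoTriangleOfIso₁₃ _ _ (Q.map_distinguished _ H) hT e₁
      (@asIso _ _ _ _ (Q.map s) hs ≪≫ e₃) ?_)⟩⟩
    change (Q.map f ≫ (Q.commShiftIso (1 : ℤ)).hom.app X₁) ≫ e₁.hom⟦1⟧' =
      (Q.map s ≫ e₃.hom) ≫ T.mor₃
    rw [← fac]
    simp [← Functor.map_comp])

end General

/-! ### Relatively split complexes and the relative derived category -/

section Derived

variable {A : Type u₁} [Category.{v₁} A] [Abelian A] {B : Type u₂} [Category.{v₂} B] [Abelian B]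

/-- Complexes (up to homotopy) that are split exact in all sufficiently high and all
sufficiently low degrees. -/
def boundedSplit (B : Type u₂) [Category.{v₂} B] [Abelian B] :
    ObjectProperty (HomotopyCategory B (ComplexShape.up ℤ)) :=
  fun K => ∃ a b : ℤ, ∀ n : ℤ, n < a ∨ b < n → IsSplitExactAt K.as n

instance : (boundedSplit B).IsClosedUnderIsomorphisms where
  of_iso {X Y} e := by
    rintro ⟨a, b, h⟩
    obtain ⟨K, rfl⟩ := HomotopyCategory.quotient_obj_surjective X
    obtain ⟨L, rfl⟩ := HomotopyCategory.quotient_obj_surjective Y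
    let e' := HomotopyCategory.homotopyEquivOfIso e
    exact ⟨a, b, fun n hn => (h n hn).of_homotopy _ _ e'.homotopyInvHomId⟩

instance : (boundedSplit B).ContainsZero where
  exists_zero := ⟨(HomotopyCategory.quotient B _).obj 0,
    Functor.map_isZero _ (isZero_zero _), 0, 0, fun n _ => ⟨0, 0, by
      apply IsZero.eq_of_src
      exact (HomologicalComplex.eval B (ComplexShape.up ℤ) n).map_isZero (isZero_zero _)⟩⟩

instance : (boundedSplit B).IsTriangulated :=
  isTriangulated_of_mappingCone _
    (fun K n => by
      rintro ⟨a, b, h⟩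
      exact ⟨a - n, b - n, fun m hm => (h (m + n) (by lia)).shift n m rfl⟩)
    (fun K L φ => by
      rintro ⟨a, b, h⟩ ⟨a', b', h'⟩
      exact ⟨min (a - 1) a', max b b', fun n hn => IsSplitExactAt.mappingCone φ
        (h (n + 1) (by lia)) (h' n (by lia))⟩)

variable (F : A ⥤ B) [F.Additive]

/-- The kernel of `F` on the homotopy category: the `F`-split acyclic complexes, i.e. those
whose image under `F` is contractible. -/
def splitAcyclic : ObjectProperty (HomotopyCategory A (ComplexShape.up ℤ)) :=
  fun K => IsZero ((F.mapHomotopyCategory (ComplexShape.up ℤ)).obj K)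

instance : (splitAcyclic F).IsClosedUnderIsomorphisms where
  of_iso e h := h.of_iso ((F.mapHomotopyCategory (ComplexShape.up ℤ)).mapIso e.symm)

instance : (splitAcyclic F).IsTriangulated where
  exists_zero := ⟨0, isZero_zero _, Functor.map_isZero _ (isZero_zero _)⟩
  isStableUnderShiftBy n := ⟨fun X hX =>
    ((shiftFunctor _ n).map_isZero hX).of_iso
      (((F.mapHomotopyCategory (ComplexShape.up ℤ)).commShiftIso n).app X)⟩
  toIsTriangulatedClosed₂ := .mk' (fun T hT h₁ h₃ =>
    Triangle.isZero₂_of_isZero₁₃ _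
      ((F.mapHomotopyCategory (ComplexShape.up ℤ)).map_distinguished T hT) h₁ h₃)

/-- The relative derived category `D_F(A)`: the Verdier quotient of the homotopy category
of unbounded cochain complexes by the `F`-split acyclic complexes. -/
abbrev DF := (splitAcyclic F).trW.Localization

/-- The localization functor from the homotopy category to `D_F(A)`. -/
abbrev DF.Q : HomotopyCategory A (ComplexShape.up ℤ) ⥤ DF F := (splitAcyclic F).trW.Q

/-- Complexes that are `F`-split acyclic in sufficiently high and low degrees. -/
def boundedSplitAcyclic : ObjectProperty (HomotopyCategory A (ComplexShape.up ℤ)) :=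
  (boundedSplit B).inverseImage (F.mapHomotopyCategory (ComplexShape.up ℤ))

instance : (boundedSplitAcyclic F).IsClosedUnderIsomorphisms := by
  unfold boundedSplitAcyclic; infer_instance

instance : (boundedSplitAcyclic F).IsTriangulated := by
  unfold boundedSplitAcyclic; infer_instance

lemma splitAcyclic_le : splitAcyclic F ≤ boundedSplitAcyclic F :=
  fun _ hX => (boundedSplit B).prop_of_isZero hX

/-- The property of objects of `D_F(A)` which defines the bounded relative derived category. -/
def boundedDF : ObjectProperty (DF F) := (boundedSplitAcyclic F).map (DF.Q F)

instance : (boundedDF F).IsClosedUnderIsomorphisms := by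
  unfold boundedDF; infer_instance

instance : (boundedDF F).IsTriangulated :=
  isTriangulated_map _ _ (fun X Y hX hY g => by
    obtain ⟨φ, hφ⟩ := Localization.exists_rightFraction (DF.Q F) (splitAcyclic F).trW g
    obtain ⟨Z, a, b, hT, hZ⟩ := φ.hs
    refine ⟨φ.X', ?_, φ.s, Localization.inverts (DF.Q F) _ _ φ.hs, φ.f, ?_⟩
    · exact (boundedSplitAcyclic F).ext_of_isTriangulatedClosed₁ _ hT hX (splitAcyclic_le F _ hZ)
    · rw [hφ]
      simp)

/-- The bounded relative derived category `D^b_F(A)`, a full subcategory of `D_F(A)`. -/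
abbrev DbF := (boundedDF F).FullSubcategory

end Derived

/-! ### Relatively projective objects -/

section Projective

variable {A : Type u₁} [Category.{v₁} A] [Abelian A] {B : Type u₂} [Category.{v₂} B] [Abelian B]

/-- `X` is a direct summand of an object in the image of `G`. For the left (resp. right) adjoint
of `F`, these are the `F`-projective (resp. `F`-injective) objects. -/
def IsSummandOfImage {A : Type u₁} [Category.{v₁} A] {B : Type u₂} [Category.{v₂} B] (G : B ⥤ A) : ObjectProperty A :=
  fun X => ∃ Y : B, Nonempty (Retract X (G.obj Y))

lemma IsSummandOfImage.of_isZero (G : B ⥤ A) {X : A} (hX : IsZero X) : IsSummandOfImage G X :=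
  ⟨0, ⟨{ i := 0, r := 0, retract := hX.eq_of_src _ _ }⟩⟩

lemma IsSummandOfImage.of_retract {A : Type u₁} [Category.{v₁} A] {B : Type u₂}
    [Category.{v₂} B] (G : B ⥤ A) {X Y : A} (r : Retract X Y)
    (hY : IsSummandOfImage G Y) : IsSummandOfImage G X := by
  obtain ⟨Z, ⟨e⟩⟩ := hY
  exact ⟨Z, ⟨r.trans e⟩⟩

lemma IsSummandOfImage.biprod (G : B ⥤ A) [G.Additive] {X Y : A} (hX : IsSummandOfImage G X)
    (hY : IsSummandOfImage G Y) : IsSummandOfImage G (X ⊞ Y) := by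
  obtain ⟨X', ⟨e⟩⟩ := hX
  obtain ⟨Y', ⟨f⟩⟩ := hY
  refine ⟨X' ⊞ Y', ⟨{
    i := biprod.fst ≫ e.i ≫ G.map biprod.inl + biprod.snd ≫ f.i ≫ G.map biprod.inr
    r := G.map biprod.fst ≫ e.r ≫ biprod.inl + G.map biprod.snd ≫ f.r ≫ biprod.inr
    retract := ?_ }⟩⟩
  have h1 : G.map (biprod.inl : X' ⟶ X' ⊞ Y') ≫ G.map biprod.fst = 𝟙 _ := by
    rw [← G.map_comp]; simp
  have h2 : G.map (biprod.inl : X' ⟶ X' ⊞ Y') ≫ G.map biprod.snd = 0 := by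
    rw [← G.map_comp]; simp
  have h3 : G.map (biprod.inr : Y' ⟶ X' ⊞ Y') ≫ G.map biprod.fst = 0 := by
    rw [← G.map_comp]; simp
  have h4 : G.map (biprod.inr : Y' ⟶ X' ⊞ Y') ≫ G.map biprod.snd = 𝟙 _ := by
    rw [← G.map_comp]; simp
  simp only [add_comp, comp_add, assoc, reassoc_of% h1, reassoc_of% h2, reassoc_of% h3,
    reassoc_of% h4, zero_comp, comp_zero, add_zero, zero_add, Retract.retract_assoc,
    biprod.total]

/-- Bounded complexes of `F`-projective objects, where `L` is the left adjoint of `F`. -/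
def boundedProj (L : B ⥤ A) : ObjectProperty (CochainComplex A ℤ) :=
  fun K => (∀ n, IsSummandOfImage L (K.X n)) ∧
    ∃ a b : ℤ, ∀ n : ℤ, n < a ∨ b < n → IsZero (K.X n)

/-- The bounded complexes of `F`-projective objects in the homotopy category. -/
def homotopyProj (L : B ⥤ A) : ObjectProperty (HomotopyCategory A (ComplexShape.up ℤ)) :=
  (boundedProj L).map (HomotopyCategory.quotient A _)

instance (L : B ⥤ A) : (homotopyProj L).IsClosedUnderIsomorphisms := by
  unfold homotopyProj; infer_instance

lemma boundedProj.mappingCone (L : B ⥤ A) [L.Additive] {K K' : CochainComplex A ℤ} (φ : K ⟶ K')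
    (hK : boundedProj L K) (hK' : boundedProj L K') : boundedProj L (mappingCone φ) := by
  obtain ⟨hK, a, b, h⟩ := hK
  obtain ⟨hK', a', b', h'⟩ := hK'
  have e (n : ℤ) : (CochainComplex.mappingCone φ).X n ≅ K.X (n + 1) ⊞ K'.X n :=
    HomologicalComplex.homotopyCofiber.XIsoBiprod φ n (n + 1) rfl
  refine ⟨fun n => (IsSummandOfImage.biprod L (hK (n + 1)) (hK' n)).of_retract L
    (Retract.ofIso (e n)), min (a - 1) a', max b b', fun n hn => ?_⟩
  refine IsZero.of_iso ?_ (e n)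
  rw [biprod_isZero_iff]
  exact ⟨h _ (by lia), h' _ (by lia)⟩

instance (L : B ⥤ A) [L.Additive] : (homotopyProj L).IsTriangulated := by
  have : (homotopyProj L).ContainsZero := ⟨_, Functor.map_isZero _ (isZero_zero _),
    ObjectProperty.prop_map_obj _ _ (X := 0)
      ⟨fun n => .of_isZero _
        ((HomologicalComplex.eval A (ComplexShape.up ℤ) n).map_isZero (isZero_zero _)),
        0, 0, fun n _ =>
        (HomologicalComplex.eval A (ComplexShape.up ℤ) n).map_isZero (isZero_zero _)⟩⟩
  refine isTriangulated_of_mappingCone _ ?_ ?_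
  · rintro K n ⟨K', ⟨hK', a, b, h⟩, ⟨e⟩⟩
    refine ⟨K'⟦n⟧, ⟨fun m => hK' (m + n), a - n, b - n, fun m hm => h (m + n) (by lia)⟩,
      ⟨((HomotopyCategory.quotient A (.up ℤ)).commShiftIso n).app _ ≪≫
      (shiftFunctor _ n).mapIso e ≪≫
      (((HomotopyCategory.quotient A (.up ℤ)).commShiftIso n).app _).symm⟩⟩
  · rintro K L φ ⟨K', hK', ⟨e⟩⟩ ⟨L', hL', ⟨e'⟩⟩
    obtain ⟨ψ, hψ⟩ := (HomotopyCategory.quotient A _).map_surjective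
      (e.hom ≫ (HomotopyCategory.quotient A _).map φ ≫ e'.inv)
    refine ⟨_, hK'.mappingCone _ ψ hL', ⟨Triangle.π₃.mapIso (isoTriangleOfIso₁₂ _ _
      (HomotopyCategory.mappingCone_triangleh_distinguished ψ)
      (HomotopyCategory.mappingCone_triangleh_distinguished φ) e e' ?_)⟩⟩
    change (HomotopyCategory.quotient A _).map ψ ≫ e'.hom =
      e.hom ≫ (HomotopyCategory.quotient A _).map φ
    rw [hψ]
    simp

variable {L R : B ⥤ A} {F : A ⥤ B} [F.Additive]

/-- A morphism from an `F`-projective object to an `F`-split exact complex lifts along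
the differential. -/
lemma exists_lift (adj : L ⊣ F) {P : A} (hP : IsSummandOfImage L P) (S : CochainComplex A ℤ)
    (n m k : ℤ) (hn : n + 1 = m) (hk : m + 1 = k)
    (hS : IsSplitExactAt ((F.mapHomologicalComplex _).obj S) m)
    (f : P ⟶ S.X m) (hf : f ≫ S.d m k = 0) : ∃ h : P ⟶ S.X n, h ≫ S.d n m = f := by
  obtain ⟨Y, ⟨e⟩⟩ := hP
  obtain ⟨s, s', hs⟩ : ∃ (s : F.obj (S.X m) ⟶ F.obj (S.X n)) (s' : F.obj (S.X k) ⟶ F.obj (S.X m)),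
      s ≫ F.map (S.d n m) + F.map (S.d m k) ≫ s' = 𝟙 _ :=
    (isSplitExactAt_iff _ n m k hn hk).1 hS
  let g : Y ⟶ F.obj (S.X m) := adj.homEquiv _ _ (e.r ≫ f)
  have hg : g ≫ F.map (S.d m k) = 0 := by
    rw [← Adjunction.homEquiv_naturality_right, assoc, hf, comp_zero,
      Adjunction.homEquiv_unit, F.map_zero, comp_zero]
  have hg' : (g ≫ s) ≫ F.map (S.d n m) = g := by
    have := g ≫= hs
    rwa [comp_add, reassoc_of% hg, zero_comp, add_zero, comp_id, ← assoc] at this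
  refine ⟨e.i ≫ (adj.homEquiv _ _).symm (g ≫ s), ?_⟩
  rw [assoc, ← Adjunction.homEquiv_naturality_right_symm, hg']
  simp [g]

/-- Morphisms from bounded complexes of `F`-projectives to `F`-split acyclic complexes vanish
in the homotopy category. -/
lemma homotopyProj_le_leftOrthogonal (adj : L ⊣ F) :
    homotopyProj L ≤ (splitAcyclic F).leftOrthogonal := by
  rintro X ⟨P, ⟨hP, a, b, hb⟩, ⟨e⟩⟩
  refine ObjectProperty.prop_of_iso _ e ?_
  intro S f hS
  obtain ⟨S, rfl⟩ := HomotopyCategory.quotient_obj_surjective S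
  obtain ⟨f, rfl⟩ := (HomotopyCategory.quotient _ _).map_surjective f
  have hS' (m : ℤ) : IsSplitExactAt ((F.mapHomologicalComplex _).obj S) m := by
    refine IsSplitExactAt.of_homotopy (K := 0) ⟨0, 0, ?_⟩ 0 0
      (HomotopyCategory.homotopyOfEq _ _ (IsZero.eq_of_src hS _ _))
    exact ((HomologicalComplex.eval B (ComplexShape.up ℤ) m).map_isZero
      (isZero_zero _)).eq_of_src _ _
  have key (k : ℕ) : ∀ f : P ⟶ S, (∀ n : ℤ, a + k ≤ n → f.f n = 0) →
      (HomotopyCategory.quotient A (ComplexShape.up ℤ)).map f = 0 := by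
    induction k with
    | zero =>
      intro f hf
      have : f = 0 := by
        ext n
        by_cases hn : n < a
        · exact (hb n (Or.inl hn)).eq_of_src _ _
        · exact hf n (by lia)
      rw [this, Functor.map_zero]
    | succ k ih =>
      intro f hf
      obtain ⟨h, hh⟩ := exists_lift adj (hP (a + k)) S (a + k - 1) (a + k) (a + k + 1) (by lia) rfl
        (hS' _) (f.f (a + k)) (by
          rw [f.comm, hf (a + k + 1) (by push_cast; lia), comp_zero])
      let h' : ∀ i j : ℤ, (ComplexShape.up ℤ).Rel j i → (P.X i ⟶ S.X j) := fun i j hij =>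
        if hi : i = a + k then (P.XIsoOfEq hi).hom ≫ h ≫
          (S.XIsoOfEq (show a + k - 1 = j by simp at hij; lia)).hom else 0
      have h0 : (HomotopyCategory.quotient A (ComplexShape.up ℤ)).map
          (Homotopy.nullHomotopicMap' h') = 0 := by
        rw [← Functor.map_zero]
        exact HomotopyCategory.eq_of_homotopy _ _ (Homotopy.nullHomotopy' h')
      have h1 := ih (f - Homotopy.nullHomotopicMap' h') (fun n hn => by
        rw [HomologicalComplex.sub_f_apply, Homotopy.nullHomotopicMap'_f
          (k₂ := n - 1) (k₁ := n) (k₀ := n + 1) (by simp) (by simp)]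
        obtain rfl | hn' := hn.eq_or_lt
        · simp [h', hh]
        · have e1 : ¬ n = a + k := by lia
          have e2 : ¬ n + 1 = a + k := by lia
          simp [h', e1, e2, hf n (by push_cast; lia)])
      rwa [Functor.map_sub, h0, sub_zero] at h1
  refine key (b + 1 - a).toNat f (fun n hn => ?_)
  exact (hb n (Or.inr (by lia))).eq_of_src _ _

end Projective

/-! ### The relative stable category -/

section Stable

variable {A : Type u₁} [Category.{v₁} A] [Abelian A] {B : Type u₂} [Category.{v₂} B] [Abelian B]
  {L R : B ⥤ A} {F : A ⥤ B}

/-- The `F`-projective objects: direct summands of objects in the image of the left adjoint. -/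
abbrev IsFProjective (_t : Adjunction.Triple L F R) : ObjectProperty A := IsSummandOfImage L

/-- The `F`-injective objects: direct summands of objects in the image of the right adjoint. -/
abbrev IsFInjective (_t : Adjunction.Triple L F R) : ObjectProperty A := IsSummandOfImage R

/-- The classes of `F`-projective and of `F`-injective objects coincide. -/
class IsFrobenius (t : Adjunction.Triple L F R) : Prop where
  projective_iff_injective (X : A) : IsFProjective t X ↔ IsFInjective t X

variable (t : Adjunction.Triple L F R)

/-- Two parallel morphisms are identified when their difference factors through an
`F`-projective object. -/
def stableRel : HomRel A := fun X Y f g =>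
  ∃ (P : A) (_ : IsFProjective t P) (a : X ⟶ P) (b : P ⟶ Y), a ≫ b = f - g

variable [F.Additive]

lemma stableRel_add ⦃X Y : A⦄ (f₁ f₂ g₁ g₂ : X ⟶ Y) (hf : stableRel t f₁ f₂)
    (hg : stableRel t g₁ g₂) : stableRel t (f₁ + g₁) (f₂ + g₂) := by
  have := t.adj₁.left_adjoint_additive
  obtain ⟨P, hP, a, b, h⟩ := hf
  obtain ⟨P', hP', a', b', h'⟩ := hg
  refine ⟨P ⊞ P', hP.biprod L hP', biprod.lift a a', biprod.desc b b', ?_⟩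
  rw [biprod.lift_desc, h, h']
  abel

instance : Congruence (stableRel t) where
  equivalence {X Y} :=
    { refl := fun f => ⟨0, .of_isZero _ (isZero_zero A), 0, 0, by simp⟩
      symm := by
        rintro f g ⟨P, hP, a, b, h⟩
        exact ⟨P, hP, -a, b, by rw [neg_comp, h, neg_sub]⟩
      trans := by
        intro f g k h h'
        obtain ⟨P, hP, a, b, h⟩ := stableRel_add t _ _ _ _ h h'
        exact ⟨P, hP, a, b, by rw [h]; abel⟩ }
  comp_left := by
    rintro X Y Z f g g' ⟨P, hP, a, b, h⟩
    exact ⟨P, hP, f ≫ a, b, by rw [assoc, h, comp_sub]⟩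
  comp_right := by
    rintro X Y Z f f' g ⟨P, hP, a, b, h⟩
    exact ⟨P, hP, a, b ≫ g, by rw [reassoc_of% h, sub_comp]⟩

/-- The `F`-stable category: the objects of `A`, and morphisms of `A` modulo those which factor
through an `F`-projective object. -/
abbrev Stable := CategoryTheory.Quotient (stableRel t)

/-- The projection functor from `A` to the `F`-stable category. -/
abbrev Stable.proj : A ⥤ Stable t := CategoryTheory.Quotient.functor (stableRel t)

instance : Preadditive (Stable t) := CategoryTheory.Quotient.preadditive _ (stableRel_add t)

instance : (Stable.proj t).Additive := CategoryTheory.Quotient.functor_additive _ (stableRel_add t)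

instance : HasZeroObject (Stable t) := (Stable.proj t).hasZeroObject_of_additive

/-- The functor sending `X` to the cokernel `Ω_F⁻¹(X)` of its canonical `F`-injective hull
`X ⟶ R F X`. -/
def cosyzygy {L R : B ⥤ A} {F : A ⥤ B} (t : Adjunction.Triple L F R) : A ⥤ A where
  obj X := cokernel (t.adj₂.unit.app X)
  map {X Y} f := cokernel.map _ _ f (R.map (F.map f)) (t.adj₂.unit.naturality f).symm

lemma cosyzygy_stableRel [IsFrobenius t] {X Y' : A} {f g : X ⟶ Y'} (h : stableRel t f g) :
    stableRel t ((cosyzygy t).map f) ((cosyzygy t).map g) := by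
  have := t.adj₁.left_adjoint_additive
  have := t.adj₂.right_adjoint_additive
  obtain ⟨P, hP, a, b, h⟩ := h
  obtain ⟨Y, ⟨e⟩⟩ := (IsFrobenius.projective_iff_injective (t := t) P).1 hP
  let η : P ⟶ R.obj (F.obj P) := t.adj₂.unit.app P
  let p : R.obj (F.obj P) ⟶ P := R.map (F.map e.i) ≫ R.map (t.adj₂.counit.app Y) ≫ e.r
  have hp : η ≫ p = 𝟙 P := by
    have := t.adj₂.unit.naturality e.i
    dsimp at this
    dsimp only [η, p]
    rw [← reassoc_of% this, Adjunction.right_triangle_components_assoc, e.retract]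
  let s : cokernel η ⟶ R.obj (F.obj P) := cokernel.desc η (𝟙 _ - p ≫ η) (by
    rw [comp_sub, reassoc_of% hp, comp_id, sub_self])
  have hs : s ≫ cokernel.π η = 𝟙 _ := by
    rw [← cancel_epi (cokernel.π η), cokernel.π_desc_assoc, sub_comp, assoc, cokernel.condition]
    simp
  refine ⟨(cosyzygy t).obj P, ?_, (cosyzygy t).map a, (cosyzygy t).map b, ?_⟩
  · rw [IsFrobenius.projective_iff_injective]
    exact ⟨F.obj P, ⟨{ i := s, r := cokernel.π η, retract := hs }⟩⟩
  · rw [← Functor.map_comp, h]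
    have hc (u : X ⟶ Y') : cokernel.π (t.adj₂.unit.app X) ≫ (cosyzygy t).map u =
        R.map (F.map u) ≫ cokernel.π (t.adj₂.unit.app Y') := by simp [cosyzygy]
    refine (cancel_epi (cokernel.π (t.adj₂.unit.app X))).1 ((hc _).trans ?_)
    rw [Functor.map_sub, Functor.map_sub, sub_comp, ← hc, ← hc]
    exact (comp_sub _ _ _).symm

/-- The suspension functor of the `F`-stable category, induced by `Ω_F⁻¹`. -/
def Stable.susp [IsFrobenius t] : Stable t ⥤ Stable t :=
  CategoryTheory.Quotient.lift _ (cosyzygy t ⋙ Stable.proj t)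
    (fun _ _ _ _ h => CategoryTheory.Quotient.sound _ (cosyzygy_stableRel t h))

/-- The data of a standard triangle `X ⟶ Y ⟶ Z ⟶ Ω_F⁻¹(X)` of the `F`-stable category: an
`F`-split short exact sequence `X ⟶ Y ⟶ Z` in `A`, and a morphism from it to the exact sequence
`X ⟶ R F X ⟶ Ω_F⁻¹(X)` which is the identity of `X`. -/
structure StandardTriangle where
  /-- the short exact sequence -/
  S : ShortComplex A
  shortExact : S.ShortExact
  split : Nonempty (S.map F).Splitting
  /-- an extension to `Y` of the canonical `F`-injective hull of `X` -/
  h : S.X₂ ⟶ R.obj (F.obj S.X₁)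
  f_h : S.f ≫ h = t.adj₂.unit.app S.X₁
  /-- the induced morphism on cokernels -/
  w : S.X₃ ⟶ (cosyzygy t).obj S.X₁
  g_w : S.g ≫ w = h ≫ cokernel.π (t.adj₂.unit.app S.X₁)

/-- A triangulated structure on the `F`-stable category with suspension induced by `Ω_F⁻¹`, whose
distinguished triangles are those isomorphic to the standard triangles. -/
structure StableTriangulation [IsFrobenius t] where
  [shift : HasShift (Stable t) ℤ]
  [additive_shift : ∀ n : ℤ, (shiftFunctor (Stable t) n).Additive]
  [pretriangulated : Pretriangulated (Stable t)]
  isTriangulated : IsTriangulated (Stable t)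
  /-- the shift by one is the given suspension -/
  suspIso : shiftFunctor (Stable t) (1 : ℤ) ≅ Stable.susp t
  distinguished_iff (T : Triangle (Stable t)) :
    T ∈ distTriang (Stable t) ↔ ∃ (E : StandardTriangle t)
      (e₁ : T.obj₁ ≅ (Stable.proj t).obj E.S.X₁)
      (e₂ : T.obj₂ ≅ (Stable.proj t).obj E.S.X₂)
      (e₃ : T.obj₃ ≅ (Stable.proj t).obj E.S.X₃),
      T.mor₁ ≫ e₂.hom = e₁.hom ≫ (Stable.proj t).map E.S.f ∧
      T.mor₂ ≫ e₃.hom = e₂.hom ≫ (Stable.proj t).map E.S.g ∧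
      T.mor₃ ≫ e₁.hom⟦(1 : ℤ)⟧' ≫ suspIso.hom.app ((Stable.proj t).obj E.S.X₁) =
        (e₃.hom ≫ (Stable.proj t).map E.w : _ ⟶ (Stable.proj t).obj ((cosyzygy t).obj E.S.X₁))

/-! ### The comparison functor -/

/-- The full subcategory `K(P)` of `D^b_F(A)`: complexes isomorphic to bounded complexes of
`F`-projective objects. -/
def KProj (_t : Adjunction.Triple L F R) : ObjectProperty (DbF F) :=
  ((homotopyProj L).map (DF.Q F)).inverseImage (boundedDF F).ι

instance : (KProj t).IsTriangulated := by
  have := t.adj₁.left_adjoint_additive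
  have : ((homotopyProj L).map (DF.Q F)).IsTriangulated :=
    isTriangulated_map _ _ (fun X Y hX _ g => by
      obtain ⟨f, rfl⟩ := (ObjectProperty.leftOrthogonal.map_bijective_of_isTriangulated
        (homotopyProj_le_leftOrthogonal t.adj₁ X hX) (DF.Q F) Y).2 g
      exact ⟨X, hX, 𝟙 X, inferInstance, f, by simp⟩)
  unfold KProj
  infer_instance

instance : (KProj t).IsClosedUnderIsomorphisms := by
  unfold KProj; infer_instance

/-- The Verdier quotient `D^b_F(A)/K(P)`. -/
abbrev DbFModKProj := (KProj t).trW.Localization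

instance (n : ℤ) : (shiftFunctor (DbFModKProj t) n).Additive := inferInstance

/-- An object of `A`, as a complex concentrated in degree zero, in `D_F(A)`. -/
abbrev singleDF (F : A ⥤ B) [F.Additive] : A ⥤ DF F :=
  HomologicalComplex.single A (ComplexShape.up ℤ) 0 ⋙ HomotopyCategory.quotient A _ ⋙ DF.Q F

lemma boundedDF_single (X : A) : boundedDF F ((singleDF F).obj X) := by
  refine ObjectProperty.prop_map_obj _ _ ⟨0, 0, fun n hn => ⟨0, 0, ?_⟩⟩
  apply IsZero.eq_of_src
  exact F.map_isZero (HomologicalComplex.isZero_single_obj_X _ _ _ _ (by lia))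

/-- The inclusion of `A` into `D^b_F(A)` as complexes concentrated in degree zero. -/
abbrev singleDbF (F : A ⥤ B) [F.Additive] : A ⥤ DbF F :=
  (boundedDF F).lift (singleDF F) boundedDF_single

lemma isZero_single_of_projective {P : A} (hP : IsFProjective t P) :
    IsZero ((singleDbF F ⋙ (KProj t).trW.Q).obj P) := by
  have h : KProj t ((singleDbF F).obj P) := by
    refine ObjectProperty.prop_map_obj _ _ (ObjectProperty.prop_map_obj _ _
      ⟨fun n => ?_, 0, 0, fun n hn => HomologicalComplex.isZero_single_obj_X _ _ _ _ (by lia)⟩)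
    by_cases hn : n = 0
    · subst hn
      exact hP.of_retract L (Retract.ofIso (HomologicalComplex.singleObjXSelf _ _ _))
    · exact .of_isZero L (HomologicalComplex.isZero_single_obj_X _ _ _ _ hn)
  let T := contractibleTriangle ((singleDbF F).obj P)
  have h' : (KProj t).trW T.mor₂ :=
    ObjectProperty.trW.mk' (KProj t) (contractible_distinguished _) h
  have := Localization.inverts (KProj t).trW.Q (KProj t).trW _ h'
  exact (((KProj t).trW.Q).map_isZero (isZero_zero _)).of_iso
    (@asIso _ _ _ _ _ this)

lemma single_map_eq {X Y : A} {f g : X ⟶ Y} (h : stableRel t f g) :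
    (singleDbF F ⋙ (KProj t).trW.Q).map f = (singleDbF F ⋙ (KProj t).trW.Q).map g := by
  obtain ⟨P, hP, a, b, h⟩ := h
  rw [← sub_eq_zero, ← Functor.map_sub, ← h, Functor.map_comp,
    (isZero_single_of_projective t hP).eq_of_tgt ((singleDbF F ⋙ (KProj t).trW.Q).map a) 0,
    zero_comp]

/-- The functor from the `F`-stable category to `D^b_F(A)/K(P)` induced by the inclusion of `A`
into complexes concentrated in degree zero. -/
def comparison : Stable t ⥤ DbFModKProj t :=
  CategoryTheory.Quotient.lift _ (singleDbF F ⋙ (KProj t).trW.Q) (fun _ _ _ _ h => single_map_eq t h)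

end Stable

end RelativeStable

end

/-!
Write `D^b` for `D^b_F(A)` and `K(P)` for its subcategory of bounded complexes of relative
projectives. The proof shows that `comparison t` is an equivalence, transports the triangulated
structure of `D^b/K(P)` along it, and identifies the result with the structure of the stable
category.

*Full faithfulness.* The functor from `A` to `D_F(A)` is fully faithful: the source of a fraction
can be truncated to nonpositive degrees (`trW_ιTruncLE`), and then a morphism to an object of `A`
factors through a cokernel (`exists_single_map_eq`). Bounded complexes of relative projectives
are left orthogonal to the `F`-split acyclic complexes, and also right orthogonal since they are
relatively injective; so morphisms in `D_F(A)` between them and arbitrary complexes are represented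
by morphisms of complexes. A morphism of `A` which vanishes in `D^b/K(P)` factors through such a
complex `P`, hence through `P⁰`, and is zero in the stable category. For fullness, a morphism is
represented by a fraction `X ⟶ Z ⟵ Y` with `Z ⟶ P` the cone of the second arrow; the composition
`X ⟶ P` factors through the brutal truncation of `P` in nonnegative degrees, which maps trivially
to `Y⟦1⟧` and hence lifts to `Z`. Subtracting this lift, `X ⟶ Z` is induced by a morphism
`X ⟶ Y` (`exists_decomposition`).

*Essential surjectivity.* Let `F K` be split exact outside `[a, b]`, with `a < b`. The counit gives
a morphism to `K` from the complex `L F (ker dᵇ)` in degree `b` whose cone, after applying `F`, is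
split exact outside `[a, b - 1]` (`isSplitExactAt_mappingCone_of_lt_or_lt`). This cone is isomorphic
to `K` modulo `K(P)`, so that every object becomes isomorphic to a complex `K` with `F K` split
exact outside a single degree. Such a complex is isomorphic in `D_F(A)` to a shift of an object of `A`
(`exists_iso_singleDF`); that degree can be chosen to be nonpositive, and then the shift is absorbed
by `Ω_F⁻¹`. The same induction shows that an object which vanishes in `D^b/K(P)` belongs to `K(P)`
(`isStablySingle_all`), so `K(P)` is thick.

*Triangles.* An `F`-split short exact sequence in `A` has a natural connecting morphism making it a
distinguished triangle (`quotientδ_distinguished`). For `X ⟶ R F X ⟶ Ω_F⁻¹ X` the middle term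
vanishes in the quotient, so the connecting morphism is an isomorphism from `Ω_F⁻¹ X` to `X⟦1⟧`. By
naturality the standard triangles are distinguished; conversely every morphism `X ⟶ Y` is
isomorphic in the stable category to the `F`-split monomorphism `X ⟶ Y ⊞ R F X`, so every
distinguished triangle is standard (`distinguished_iff_standard`).
-/

noncomputable section

namespace RelativeStable

/-! ### Homotopy equivalences from split exactness -/

section HomotopyEquivalences

variable {B : Type u₂} [Category.{v₂} B] [Abelian B]

/-- A monomorphism of complexes `i : X' ⟶ X` which behaves like the truncation
`τ^{≤ n} X ⟶ X` is a homotopy equivalence if `X` is split exact in degrees `> n`. -/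
lemma isIso_quotient_map_of_isIso_lt {X' X : CochainComplex B ℤ} (i : X' ⟶ X) (n : ℤ)
    (h₁ : ∀ k, k < n → IsIso (i.f k)) (hn : Mono (i.f n))
    (h₂ : ∀ ⦃W : B⦄ (f : W ⟶ X.X n), f ≫ X.d n (n + 1) = 0 → ∃ g, g ≫ i.f n = f)
    (h₃ : ∀ k, n < k → IsZero (X'.X k)) (hX : ∀ k, n < k → IsSplitExactAt X k) :
    IsIso ((HomotopyCategory.quotient B (ComplexShape.up ℤ)).map i) := by
  have H (i j k : ℤ) (hij : i + 1 = j) (hjk : j + 1 = k) (hj : n < j) :=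
    (isSplitExactAt_iff X i j k hij hjk).1 (hX j hj)
  choose s s' hs using H
  -- the local splittings are corrected to `s d s'`, so that they fit together in degrees `> n`
  let h : ∀ i j : ℤ, (ComplexShape.up ℤ).Rel j i → (X.X i ⟶ X.X j) := fun i j hij =>
    if hj : n < j then s j i (i + 1) hij rfl (by simp at hij; lia) ≫ X.d j i ≫
      s' (j - 1) j i (by lia) hij hj
    else if hi : n < i then s j i (i + 1) hij rfl hi else 0
  have hh (k : ℤ) (hk : n < k) : h k (k - 1) (by simp) ≫ X.d (k - 1) k +
      X.d k (k + 1) ≫ h (k + 1) k (by simp) = 𝟙 _ := by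
    have e1 : X.d k (k + 1) ≫ h (k + 1) k (by simp) =
        X.d k (k + 1) ≫ s' (k - 1) k (k + 1) (by lia) rfl hk := by
      have := hs k (k + 1) (k + 1 + 1) rfl rfl (by lia)
      have e : s k (k + 1) (k + 1 + 1) rfl rfl (by lia) ≫ X.d k (k + 1) = 𝟙 _ -
        X.d (k + 1) (k + 1 + 1) ≫ s' k (k + 1) (k + 1 + 1) rfl rfl (by lia) := by
        rw [← this]; abel
      simp only [h, hk, dite_true, reassoc_of% e, sub_comp, id_comp, comp_sub, assoc,
        HomologicalComplex.d_comp_d_assoc, zero_comp, sub_zero]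
    have e2 : h k (k - 1) (by simp) ≫ X.d (k - 1) k =
        s (k - 1) k (k + 1) (by lia) rfl hk ≫ X.d (k - 1) k := by
      by_cases hk' : n < k - 1
      · have := hs (k - 1 - 1) (k - 1) k (by lia) (by lia) hk'
        have e : X.d (k - 1) k ≫ s' (k - 1 - 1) (k - 1) k (by lia) (by lia) hk' = 𝟙 _ -
          s (k - 1 - 1) (k - 1) k (by lia) (by lia) hk' ≫ X.d _ _ := by
          rw [← this]; abel
        simp only [h, hk', dite_true, e, sub_comp, id_comp, comp_sub, assoc,
          HomologicalComplex.d_comp_d, comp_zero, sub_zero]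
      · simp only [h, hk', hk, dite_true, dite_false]
    rw [e1, e2, hs]
  have hf (k : ℤ) : (Homotopy.nullHomotopicMap' h).f k =
      X.d k (k + 1) ≫ h (k + 1) k (by simp) + h k (k - 1) (by simp) ≫ X.d (k - 1) k :=
    Homotopy.nullHomotopicMap'_f (by simp) (by simp) h
  -- `e` is homotopic to the identity and vanishes where `X` is split exact
  let e : X ⟶ X := 𝟙 X - Homotopy.nullHomotopicMap' h
  have he_gt (k : ℤ) (hk : n < k) : e.f k = 0 := by
    dsimp [e]
    rw [hf, add_comm, hh k hk, sub_self]
  have hr (k : ℤ) : ∃ r : X.X k ⟶ X'.X k, r ≫ i.f k = e.f k := by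
    obtain hk | rfl | hk := lt_trichotomy k n
    · have := h₁ k hk
      exact ⟨e.f k ≫ inv (i.f k), by simp⟩
    · exact h₂ _ (by rw [e.comm, he_gt _ (by lia), comp_zero])
    · exact ⟨0, by rw [he_gt k hk, zero_comp]⟩
  have hi (k : ℤ) : Mono (i.f k) := by
    obtain hk | rfl | hk := lt_trichotomy k n
    · have := h₁ k hk
      infer_instance
    · exact hn
    · exact (h₃ k hk).mono _
  choose r hr using hr
  let R : X ⟶ X' :=
    { f := r
      comm' := fun j k _ => by
        rw [← cancel_mono (i.f k), assoc, assoc, ← i.comm, reassoc_of% hr j, hr k, e.comm] }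
  have hR : R ≫ i = e := by
    ext k
    exact hr k
  refine (HomotopyCategory.isoOfHomotopyEquiv ⟨i, R, Homotopy.ofEq ?_, ?_⟩).isIso_hom
  · ext k
    rw [← cancel_mono (i.f k)]
    dsimp [R]
    rw [assoc, hr, id_comp]
    obtain hk | rfl | hk := lt_trichotomy k n
    · have hk₁ : ¬ n < k + 1 := by lia
      have hk₂ : ¬ n < k := by lia
      have hk₃ : ¬ n < k - 1 := by lia
      dsimp [e]
      rw [hf]
      simp [h, hk₁, hk₂, hk₃]
    · dsimp [e]
      have h0 : i.f k ≫ X.d k (k + 1) = 0 := by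
        rw [i.comm, (h₃ (k + 1) (by lia)).eq_of_src (i.f (k + 1)) 0, comp_zero]
      have hk₃ : ¬ k < k - 1 := by lia
      rw [hf, comp_sub, comp_add, reassoc_of% h0]
      simp [h, hk₃]
    · exact (h₃ k hk).eq_of_src _ _
  · rw [hR]
    exact (Homotopy.equivSubZero.symm ((Homotopy.ofEq (by simp [e])).trans
      ((Homotopy.nullHomotopy' h).symm.trans (Homotopy.ofEq rfl)).symm)).symm

/-- An epimorphism of complexes `p : X ⟶ X'` which behaves like the truncation
`X ⟶ τ^{≥ n} X` is a homotopy equivalence if `X` is split exact in degrees `< n`. -/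
lemma isIso_quotient_map_of_isIso_gt {X X' : CochainComplex B ℤ} (p : X ⟶ X') (n : ℤ)
    (h₁ : ∀ k, n < k → IsIso (p.f k)) (hn : Epi (p.f n))
    (h₂ : ∀ ⦃W : B⦄ (f : X.X n ⟶ W), X.d (n - 1) n ≫ f = 0 → ∃ g, p.f n ≫ g = f)
    (h₃ : ∀ k, k < n → IsZero (X'.X k)) (hX : ∀ k, k < n → IsSplitExactAt X k) :
    IsIso ((HomotopyCategory.quotient B (ComplexShape.up ℤ)).map p) := by
  have H (i j k : ℤ) (hij : i + 1 = j) (hjk : j + 1 = k) (hj : j < n) :=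
    (isSplitExactAt_iff X i j k hij hjk).1 (hX j hj)
  choose s s' hs using H
  -- the local splittings are corrected to `s d s'`, so that they fit together in degrees `< n`
  let h : ∀ i j : ℤ, (ComplexShape.up ℤ).Rel j i → (X.X i ⟶ X.X j) := fun i j hij =>
    if hi : i < n then s j i (i + 1) hij rfl hi ≫ X.d j i ≫
      s' (j - 1) j i (by lia) hij (by simp at hij; lia)
    else if hj : j < n then s' (j - 1) j i (by lia) hij hj else 0
  have hh (k : ℤ) (hk : k < n) : h k (k - 1) (by simp) ≫ X.d (k - 1) k +
      X.d k (k + 1) ≫ h (k + 1) k (by simp) = 𝟙 _ := by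
    have e1 : X.d k (k + 1) ≫ h (k + 1) k (by simp) =
        X.d k (k + 1) ≫ s' (k - 1) k (k + 1) (by lia) rfl hk := by
      by_cases hk' : k + 1 < n
      · have := hs k (k + 1) (k + 1 + 1) rfl rfl hk'
        have e : s k (k + 1) (k + 1 + 1) rfl rfl hk' ≫ X.d k (k + 1) = 𝟙 _ -
          X.d (k + 1) (k + 1 + 1) ≫ s' k (k + 1) (k + 1 + 1) rfl rfl hk' := by
          rw [← this]; abel
        simp only [h, hk', dite_true, reassoc_of% e, sub_comp, id_comp, comp_sub, assoc,
          HomologicalComplex.d_comp_d_assoc, zero_comp, sub_zero]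
      · simp only [h, hk', hk, dite_true, dite_false]
    have e2 : h k (k - 1) (by simp) ≫ X.d (k - 1) k =
        s (k - 1) k (k + 1) (by lia) rfl hk ≫ X.d (k - 1) k := by
      have := hs (k - 1 - 1) (k - 1) k (by lia) (by lia) (by lia)
      have e : X.d (k - 1) k ≫ s' (k - 1 - 1) (k - 1) k (by lia) (by lia) (by lia) = 𝟙 _ -
        s (k - 1 - 1) (k - 1) k (by lia) (by lia) (by lia) ≫ X.d _ _ := by
        rw [← this]; abel
      simp only [h, hk, dite_true, e, sub_comp, id_comp, comp_sub, assoc,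
        HomologicalComplex.d_comp_d, comp_zero, sub_zero]
    rw [e1, e2, hs]
  have hf (k : ℤ) : (Homotopy.nullHomotopicMap' h).f k =
      X.d k (k + 1) ≫ h (k + 1) k (by simp) + h k (k - 1) (by simp) ≫ X.d (k - 1) k :=
    Homotopy.nullHomotopicMap'_f (by simp) (by simp) h
  -- `e` is homotopic to the identity and vanishes where `X` is split exact
  let e : X ⟶ X := 𝟙 X - Homotopy.nullHomotopicMap' h
  have he_lt (k : ℤ) (hk : k < n) : e.f k = 0 := by
    dsimp [e]
    rw [hf, add_comm, hh k hk, sub_self]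
  have hr (k : ℤ) : ∃ r : X'.X k ⟶ X.X k, p.f k ≫ r = e.f k := by
    obtain hk | rfl | hk := lt_trichotomy k n
    · exact ⟨0, by rw [he_lt k hk, comp_zero]⟩
    · exact h₂ _ (by rw [← e.comm, he_lt _ (by lia), zero_comp])
    · have := h₁ k hk
      exact ⟨inv (p.f k) ≫ e.f k, by simp⟩
  have hi (k : ℤ) : Epi (p.f k) := by
    obtain hk | rfl | hk := lt_trichotomy k n
    · exact (h₃ k hk).epi _
    · exact hn
    · have := h₁ k hk
      infer_instance
  choose r hr using hr
  let R : X' ⟶ X :=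
    { f := r
      comm' := fun j k _ => by
        rw [← cancel_epi (p.f j), reassoc_of% hr j, p.comm_assoc, hr k, e.comm] }
  have hR : p ≫ R = e := by
    ext k
    exact hr k
  refine (HomotopyCategory.isoOfHomotopyEquiv ⟨p, R, ?_, Homotopy.ofEq ?_⟩).isIso_hom
  · rw [hR]
    exact (Homotopy.equivSubZero.symm ((Homotopy.ofEq (by simp [e])).trans
      ((Homotopy.nullHomotopy' h).symm.trans (Homotopy.ofEq rfl)).symm)).symm
  · ext k
    rw [← cancel_epi (p.f k)]
    dsimp [R]
    rw [reassoc_of% hr, comp_id]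
    obtain hk | rfl | hk := lt_trichotomy k n
    · exact (h₃ k hk).eq_of_tgt _ _
    · dsimp [e]
      have h0 : X.d (k - 1) k ≫ p.f k = 0 := by
        rw [← p.comm, (h₃ (k - 1) (by lia)).eq_of_tgt (p.f (k - 1)) 0, zero_comp]
      have hk₃ : ¬ k + 1 < k := by lia
      rw [hf, sub_comp, add_comp, assoc, assoc, h0]
      simp [h, hk₃]
    · have hk₁ : ¬ k - 1 < n := by lia
      have hk₂ : ¬ k < n := by lia
      have hk₃ : ¬ k + 1 < n := by lia
      dsimp [e]
      rw [hf]
      simp [h, hk₁, hk₂, hk₃]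

open CochainComplex.HomComplex in
/-- For a degreewise split sequence of complexes, the cone of the first morphism is homotopy
equivalent to the quotient; the homotopy inverse has the splitting and its coboundary as
components. -/
lemma isIso_quotient_map_descShortComplex (S : ShortComplex (CochainComplex B ℤ))
    (σ : ∀ n, (S.map (HomologicalComplex.eval B (ComplexShape.up ℤ) n)).Splitting) :
    IsIso ((HomotopyCategory.quotient B (ComplexShape.up ℤ)).map
      (mappingCone.descShortComplex S)) := by
  obtain ⟨s, hs⟩ : ∃ s : ∀ n, S.X₃.X n ⟶ S.X₂.X n, ∀ n, s n = (σ n).s := ⟨_, fun _ => rfl⟩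
  obtain ⟨r, hr⟩ : ∃ r : ∀ n, S.X₂.X n ⟶ S.X₁.X n, ∀ n, r n = (σ n).r := ⟨_, fun _ => rfl⟩
  have r_f (n : ℤ) : r n ≫ S.f.f n = 𝟙 _ - S.g.f n ≫ s n := by
    rw [hr, hs]; exact (σ n).r_f
  have f_r (n : ℤ) : S.f.f n ≫ r n = 𝟙 _ := by rw [hr]; exact (σ n).f_r
  have s_g (n : ℤ) : s n ≫ S.g.f n = 𝟙 _ := by rw [hs]; exact (σ n).s_g
  have g_s (n : ℤ) : S.g.f n ≫ s n = 𝟙 _ - r n ≫ S.f.f n := by rw [r_f]; abel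
  let α : Cocycle S.X₃ S.X₁ 1 := cocycleOfDegreewiseSplit S σ
  let β : Cochain S.X₃ S.X₂ 0 := Cochain.ofHoms s
  let ρ : Cochain S.X₂ S.X₁ 0 := Cochain.ofHoms r
  have hα (n : ℤ) : α.1.v n (n + 1) rfl = s n ≫ S.X₂.d n (n + 1) ≫ r (n + 1) := by
    rw [hr, hs]; rfl
  let j : S.X₃ ⟶ CochainComplex.mappingCone S.f := mappingCone.lift S.f (-α) β (by
    ext p _ rfl
    rw [Cochain.add_v, δ_v 0 1 (by lia) β p (p + 1) rfl p (p + 1) (by lia) rfl]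
    simp only [β, Cochain.ofHoms_v, Cocycle.coe_neg, Cochain.neg_comp, Cochain.neg_v,
      Cochain.comp_zero_cochain_v, Cochain.ofHom_v, hα, assoc, r_f, comp_sub, comp_id,
      ← S.g.comm_assoc, reassoc_of% (s_g p)]
    simp
    abel)
  have h1 : j ≫ mappingCone.descShortComplex S = 𝟙 _ := by
    ext n
    rw [HomologicalComplex.comp_f]
    dsimp only [j, mappingCone.descShortComplex]
    rw [mappingCone.lift_desc_f _ _ _ _ _ _ _ _ _ rfl]
    simp [β, s_g]
  have h2 : Homotopy (mappingCone.descShortComplex S ≫ j) (𝟙 _) := by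
    refine mappingCone.descHomotopy _ _ _ 0 (-(ρ.comp (mappingCone.inl S.f) (zero_add (-1)))) ?_ ?_
    · ext p q hpq
      simp [ρ, reassoc_of% f_r]
    · ext n
      rw [Cochain.add_v, δ_v (-1) 0 (by lia) _ n n (by lia) (n - 1) (n + 1) (by lia) (by lia)]
      simp only [ρ, Cochain.neg_v, Cochain.zero_cochain_comp_v, Cochain.ofHoms_v,
        Cochain.ofHom_v, mappingCone.inr_descShortComplex_assoc, HomologicalComplex.comp_f,
        comp_id, j]
      rw [mappingCone.lift_f _ _ _ _ n (n + 1) rfl]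
      simp only [Cocycle.coe_neg, Cochain.neg_v, hα, β, Cochain.ofHoms_v, neg_comp, comp_add,
        comp_neg, assoc, mappingCone.inl_v_d S.f n (n - 1) (n + 1) (by lia) (by lia), comp_sub,
        reassoc_of% g_s, sub_comp, id_comp, S.f.comm_assoc, reassoc_of% f_r]
      simp
      abel
  exact (HomotopyCategory.isoOfHomotopyEquiv
    ⟨mappingCone.descShortComplex S, j, h2, Homotopy.ofEq h1⟩).isIso_hom

end HomotopyEquivalences

/-! ### Morphisms inverted in the relative derived category -/

section Truncations

section

variable {C ι ι' : Type*} [Category* C] [HasZeroMorphisms C] [HasZeroObject C]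
  {c : ComplexShape ι} {c' : ComplexShape ι'} (K : HomologicalComplex C c')
  [∀ i', K.HasHomology i'] (e : c.Embedding c')

/-- The truncation `K ⟶ τ^{≥} K` is an isomorphism away from the boundary degree. -/
lemma isIso_πTruncGE_f [e.IsTruncGE] {i : ι} {i' : ι'} (hi : e.f i = i')
    (hb : ¬ e.BoundaryGE i) : IsIso ((K.πTruncGE e).f i') := by
  exact (e.isIso_liftExtend_f_iff _ (K.restrictionToTruncGE'_hasLift e) hi).2
    (K.isIso_restrictionToTruncGE' e i hb)

/-- In the boundary degree, the truncation is a cokernel of the incoming differential. -/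
lemma exists_πTruncGE_f_comp_eq [e.IsTruncGE] {i : ι} {i' j' : ι'} (hi : e.f i = i')
    (hb : e.BoundaryGE i) (hj : c'.prev i' = j') {W : C} (f : K.X i' ⟶ W)
    (hf : K.d j' i' ≫ f = 0) : ∃ g, (K.πTruncGE e).f i' ≫ g = f := by
  let g : ((K.truncGE' e).extend e).X i' ⟶ W :=
    ((K.truncGE' e).extendXIso e hi).hom ≫ (K.truncGE'XIsoOpcycles e hi hb).hom ≫
      K.descOpcycles f j' hj hf
  have h : (e.liftExtend _ (K.restrictionToTruncGE'_hasLift e)).f i' ≫ g = f := by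
    rw [e.liftExtend_f _ _ hi, K.restrictionToTruncGE'_f_eq_iso_hom_pOpcycles_iso_inv e hi hb]
    simp [g]
  exact ⟨g, h⟩

lemma isIso_ιTruncLE_f [e.IsTruncLE] {i : ι} {i' : ι'} (hi : e.f i = i')
    (hb : ¬ e.BoundaryLE i) : IsIso ((K.ιTruncLE e).f i') := by
  have := isIso_πTruncGE_f K.op e.op hi (by simpa using hb)
  exact inferInstanceAs (IsIso ((K.op.πTruncGE e.op).f i').unop)

lemma exists_comp_ιTruncLE_f_eq [e.IsTruncLE] {i : ι} {i' j' : ι'} (hi : e.f i = i')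
    (hb : e.BoundaryLE i) (hj : c'.next i' = j') {W : C} (f : W ⟶ K.X i')
    (hf : f ≫ K.d i' j' = 0) : ∃ g, g ≫ (K.ιTruncLE e).f i' = f := by
  obtain ⟨g, hg⟩ := exists_πTruncGE_f_comp_eq K.op e.op (j' := j') hi (by simpa using hb)
    hj f.op (Quiver.Hom.unop_inj hf)
  exact ⟨g.unop, Quiver.Hom.op_inj hg⟩

end

variable {A : Type u₁} [Category.{v₁} A] [Abelian A] {B : Type u₂} [Category.{v₂} B] [Abelian B]
  (F : A ⥤ B) [F.Additive]

lemma trW_splitAcyclic_iff {X Y : HomotopyCategory A (ComplexShape.up ℤ)} (f : X ⟶ Y) :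
    (splitAcyclic F).trW f ↔ IsIso ((F.mapHomotopyCategory (ComplexShape.up ℤ)).map f) := by
  obtain ⟨Z, g, h, hT⟩ := distinguished_cocone_triangle f
  exact ((splitAcyclic F).trW_iff_of_distinguished _ hT).trans <| Triangle.isZero₃_iff_isIso₁ _
    ((F.mapHomotopyCategory (ComplexShape.up ℤ)).map_distinguished _ hT)

lemma trW_splitAcyclic_quotient_map_iff {K L : CochainComplex A ℤ} (f : K ⟶ L) :
    (splitAcyclic F).trW ((HomotopyCategory.quotient A _).map f) ↔
      IsIso ((HomotopyCategory.quotient B _).map ((F.mapHomologicalComplex _).map f)) :=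
  trW_splitAcyclic_iff F _

variable {F}

/-- Split exactness after applying `F` is invariant under morphisms inverted in `D_F(A)`. -/
lemma isSplitExactAt_iff_of_trW {K K' : CochainComplex A ℤ} (f : K ⟶ K')
    (hf : (splitAcyclic F).trW ((HomotopyCategory.quotient A _).map f)) (n : ℤ) :
    IsSplitExactAt ((F.mapHomologicalComplex _).obj K) n ↔
      IsSplitExactAt ((F.mapHomologicalComplex _).obj K') n := by
  rw [trW_splitAcyclic_quotient_map_iff] at hf
  obtain ⟨g, hg⟩ := (HomotopyCategory.quotient B _).map_surjective
    (inv ((HomotopyCategory.quotient B _).map ((F.mapHomologicalComplex _).map f)))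
  exact ⟨fun h => h.of_homotopy g ((F.mapHomologicalComplex _).map f)
      (HomotopyCategory.homotopyOfEq _ _ (by simp [hg])),
    fun h => h.of_homotopy ((F.mapHomologicalComplex _).map f) g
      (HomotopyCategory.homotopyOfEq _ _ (by simp [hg]))⟩

/-- If `F K` is split exact above degree `n`, the truncation `τ^{≤ n} K ⟶ K` is an isomorphism
in the relative derived category. -/
lemma trW_ιTruncLE [PreservesFiniteLimits F] [PreservesFiniteColimits F] (K : CochainComplex A ℤ)
    (n : ℤ) (hK : ∀ k, n < k → IsSplitExactAt ((F.mapHomologicalComplex _).obj K) k) :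
    (splitAcyclic F).trW ((HomotopyCategory.quotient A _).map (K.ιTruncLE n)) := by
  rw [trW_splitAcyclic_quotient_map_iff]
  have hb : (ComplexShape.embeddingUpIntLE n).BoundaryLE 0 := by
    rw [ComplexShape.boundaryLE_embeddingUpIntLE_iff]
  have h0 : (ComplexShape.embeddingUpIntLE n).f 0 = n := by simp
  have hm : Mono ((K.ιTruncLE n).f n) := by
    dsimp only [CochainComplex.ιTruncLE]
    infer_instance
  refine isIso_quotient_map_of_isIso_lt
    ((F.mapHomologicalComplex (ComplexShape.up ℤ)).map (K.ιTruncLE n)) n ?_ ?_ ?_ ?_ hK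
  · intro k hk
    have : IsIso ((K.ιTruncLE n).f k) :=
      isIso_ιTruncLE_f K (ComplexShape.embeddingUpIntLE n) (i := (n - k).natAbs)
        (by simp only [ComplexShape.embeddingUpIntLE_f]; lia)
        (by rw [ComplexShape.boundaryLE_embeddingUpIntLE_iff]; lia)
    exact inferInstanceAs (IsIso (F.map ((K.ιTruncLE n).f k)))
  · exact inferInstanceAs (Mono (F.map ((K.ιTruncLE n).f n)))
  · intro W f hf
    let S : ShortComplex A := ShortComplex.mk ((K.ιTruncLE n).f n) (K.d n (n + 1)) (by
      rw [(K.ιTruncLE n).comm,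
        ((K.truncLE n).isZero_of_isStrictlyLE n (n + 1)).eq_of_src ((K.ιTruncLE n).f (n + 1)) 0,
        comp_zero])
    have hS : S.Exact := by
      refine ShortComplex.exact_of_f_is_kernel _ (KernelFork.IsLimit.ofι' _ _ (fun f hf => ?_))
      have := exists_comp_ιTruncLE_f_eq K (ComplexShape.embeddingUpIntLE n) h0 hb
        (CochainComplex.next ℤ n) f hf
      exact ⟨this.choose, this.choose_spec⟩
    have hF := hS.map F
    have : Mono (S.map F).f := inferInstanceAs (Mono (F.map ((K.ιTruncLE n).f n)))
    exact ⟨hF.lift f hf, hF.lift_f f hf⟩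
  · intro k hk
    exact F.map_isZero ((K.truncLE n).isZero_of_isStrictlyLE n k)

/-- If `F K` is split exact below degree `n`, the truncation `K ⟶ τ^{≥ n} K` is an isomorphism
in the relative derived category. -/
lemma trW_πTruncGE [PreservesFiniteLimits F] [PreservesFiniteColimits F] (K : CochainComplex A ℤ)
    (n : ℤ) (hK : ∀ k, k < n → IsSplitExactAt ((F.mapHomologicalComplex _).obj K) k) :
    (splitAcyclic F).trW ((HomotopyCategory.quotient A _).map (K.πTruncGE n)) := by
  rw [trW_splitAcyclic_quotient_map_iff]
  have hb : (ComplexShape.embeddingUpIntGE n).BoundaryGE 0 := by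
    rw [ComplexShape.boundaryGE_embeddingUpIntGE_iff]
  have h0 : (ComplexShape.embeddingUpIntGE n).f 0 = n := by simp
  have hm : Epi ((K.πTruncGE n).f n) := by
    dsimp only [CochainComplex.πTruncGE]
    infer_instance
  refine isIso_quotient_map_of_isIso_gt
    ((F.mapHomologicalComplex (ComplexShape.up ℤ)).map (K.πTruncGE n)) n ?_ ?_ ?_ ?_ hK
  · intro k hk
    have : IsIso ((K.πTruncGE n).f k) :=
      isIso_πTruncGE_f K (ComplexShape.embeddingUpIntGE n) (i := (k - n).natAbs)
        (by simp only [ComplexShape.embeddingUpIntGE_f]; lia)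
        (by rw [ComplexShape.boundaryGE_embeddingUpIntGE_iff]; lia)
    exact inferInstanceAs (IsIso (F.map ((K.πTruncGE n).f k)))
  · exact inferInstanceAs (Epi (F.map ((K.πTruncGE n).f n)))
  · intro W f hf
    let S : ShortComplex A := ShortComplex.mk (K.d (n - 1) n) ((K.πTruncGE n).f n) (by
      rw [← (K.πTruncGE n).comm,
        ((K.truncGE n).isZero_of_isStrictlyGE n (n - 1)).eq_of_tgt ((K.πTruncGE n).f (n - 1)) 0,
        zero_comp])
    have hS : S.Exact := by
      refine ShortComplex.exact_of_g_is_cokernel _ (CokernelCofork.IsColimit.ofπ' _ _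
        (fun f hf => ?_))
      have := exists_πTruncGE_f_comp_eq K (ComplexShape.embeddingUpIntGE n) h0 hb
        (CochainComplex.prev ℤ n) f hf
      exact ⟨this.choose, this.choose_spec⟩
    have hF := hS.map F
    have : Epi (S.map F).g := inferInstanceAs (Epi (F.map ((K.πTruncGE n).f n)))
    exact ⟨hF.desc f hf, hF.g_desc f hf⟩
  · intro k hk
    exact F.map_isZero ((K.truncGE n).isZero_of_isStrictlyGE n k)

/-- A degreewise `F`-split sequence of complexes induces an isomorphism in the relative derived
category from the cone of its first morphism. -/
lemma trW_descShortComplex (S : ShortComplex (CochainComplex A ℤ))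
    (σ : ∀ n, Nonempty (((S.map (F.mapHomologicalComplex (ComplexShape.up ℤ))).map
      (HomologicalComplex.eval B (ComplexShape.up ℤ) n)).Splitting)) :
    (splitAcyclic F).trW
      ((HomotopyCategory.quotient A _).map (mappingCone.descShortComplex S)) := by
  rw [trW_splitAcyclic_quotient_map_iff]
  have h₁ := isIso_quotient_map_descShortComplex _ (fun n => (σ n).some)
  have h₂ : IsIso ((HomotopyCategory.quotient B _).map
    (mappingCone.mapHomologicalComplexIso S.f F).hom) := inferInstance
  have h₃ := mappingCone.mapHomologicalComplexIso_hom_descShortComplex F S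
  rw [← h₃]
  have := @IsIso.comp_isIso _ _ _ _ _ _ _ h₂ h₁
  exact this

end Truncations

/-! ### Objects of `A` in degree zero -/

section Single

variable {A : Type u₁} [Category.{v₁} A] [Abelian A] {B : Type u₂} [Category.{v₂} B] [Abelian B]
  (F : A ⥤ B) [F.Additive]

/-- Homotopic morphisms between complexes, one of which vanishes outside degree zero, agree in
degree zero if the source or target of the homotopy vanishes. -/
lemma f_zero_eq_of_homotopy {K L : CochainComplex B ℤ} {f g : K ⟶ L} (h : Homotopy f g)
    (hL : IsZero (L.X (-1))) (hK : IsZero (K.X 1)) : f.f 0 = g.f 0 := by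
  have := h.comm 0
  rwa [dNext_eq h.hom (show (ComplexShape.up ℤ).Rel 0 1 by simp),
    prevD_eq h.hom (show (ComplexShape.up ℤ).Rel (-1) 0 by simp),
    hK.eq_of_src (h.hom 1 0) 0, hL.eq_of_tgt (h.hom 0 (-1)) 0, comp_zero, zero_comp, zero_add,
    zero_add] at this

lemma isZero_map_single_X (X : A) (n : ℤ) (hn : n ≠ 0) :
    IsZero (((F.mapHomologicalComplex (ComplexShape.up ℤ)).obj
      ((HomologicalComplex.single A (ComplexShape.up ℤ) 0).obj X)).X n) :=
  F.map_isZero (HomologicalComplex.isZero_single_obj_X _ _ _ _ hn)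

variable [F.Faithful]

lemma eq_zero_of_quotient_map_single_eq_zero {X Y : A} (f : X ⟶ Y)
    (hf : (F.mapHomotopyCategory (ComplexShape.up ℤ)).map ((HomotopyCategory.quotient A _).map
      ((HomologicalComplex.single A (ComplexShape.up ℤ) 0).map f)) = 0) : f = 0 := by
  have h : (HomotopyCategory.quotient B _).map ((F.mapHomologicalComplex (ComplexShape.up ℤ)).map
      ((HomologicalComplex.single A (ComplexShape.up ℤ) 0).map f)) =
      (HomotopyCategory.quotient B _).map 0 := by
    rw [Functor.map_zero]
    exact hf
  have h0 := f_zero_eq_of_homotopy (HomotopyCategory.homotopyOfEq _ _ h)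
    (isZero_map_single_X F Y _ (by lia)) (isZero_map_single_X F X _ (by lia))
  have h1 : ((HomologicalComplex.single A (ComplexShape.up ℤ) 0).map f).f 0 = 0 :=
    F.map_injective (h0.trans (F.map_zero _ _).symm)
  rw [HomologicalComplex.single_map_f_self] at h1
  simpa using h1

lemma singleDF_map_eq_zero {X Y : A} (f : X ⟶ Y) (hf : (singleDF F).map f = 0) : f = 0 := by
  have h : (DF.Q F).map ((HomotopyCategory.quotient A _).map
      ((HomologicalComplex.single A (ComplexShape.up ℤ) 0).map f)) = (DF.Q F).map 0 := by
    rw [Functor.map_zero]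
    exact hf
  rw [MorphismProperty.map_eq_iff_precomp (DF.Q F) (splitAcyclic F).trW] at h
  obtain ⟨Z, s, hs, eq⟩ := h
  rw [trW_splitAcyclic_iff] at hs
  refine eq_zero_of_quotient_map_single_eq_zero F f ?_
  rw [← cancel_epi ((F.mapHomotopyCategory (ComplexShape.up ℤ)).map s), ← Functor.map_comp, eq,
    comp_zero, Functor.map_zero, comp_zero]

instance : (singleDF F).Faithful where
  map_injective {X Y f g} h := by
    rw [← sub_eq_zero]
    exact singleDF_map_eq_zero F _ (by rw [Functor.map_sub, h, sub_self])

variable [PreservesFiniteLimits F] [PreservesFiniteColimits F]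

/-- A fraction `X ⟵ Z ⟶ Y` between objects of `A` in degree zero, where `Z` vanishes in degree one,
is induced by a morphism `X ⟶ Y`: the degree zero component of `s` is a cokernel of `Z⁻¹ ⟶ Z⁰`. -/
lemma exists_single_map_eq (X Y : A) (Z : CochainComplex A ℤ) (hZ : IsZero (Z.X 1))
    (s : Z ⟶ (HomologicalComplex.single A (ComplexShape.up ℤ) 0).obj X)
    (hs : (splitAcyclic F).trW ((HomotopyCategory.quotient A _).map s))
    (f : Z ⟶ (HomologicalComplex.single A (ComplexShape.up ℤ) 0).obj Y) :
    ∃ a : X ⟶ Y, s ≫ (HomologicalComplex.single A (ComplexShape.up ℤ) 0).map a = f := by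
  rw [trW_splitAcyclic_quotient_map_iff] at hs
  obtain ⟨g, hg⟩ := (HomotopyCategory.quotient B _).map_surjective
    (inv ((HomotopyCategory.quotient B _).map ((F.mapHomologicalComplex _).map s)))
  have h₁ := HomotopyCategory.homotopyOfEq (g ≫ (F.mapHomologicalComplex _).map s) (𝟙 _)
    (by simp [hg])
  have h₂ := HomotopyCategory.homotopyOfEq ((F.mapHomologicalComplex _).map s ≫ g) (𝟙 _)
    (by simp [hg])
  let g₀ : F.obj (((HomologicalComplex.single A (ComplexShape.up ℤ) 0).obj X).X 0) ⟶
    F.obj (Z.X 0) := g.f 0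
  have e₁ : g₀ ≫ F.map (s.f 0) = 𝟙 _ :=
    f_zero_eq_of_homotopy h₁ (isZero_map_single_X F X _ (by lia))
      (isZero_map_single_X F X _ (by lia))
  have e₂ : ∃ t, F.map (s.f 0) ≫ g₀ = t ≫ F.map (Z.d (-1) 0) + 𝟙 _ := by
    have z : IsZero (((F.mapHomologicalComplex (ComplexShape.up ℤ)).obj Z).X 1) := F.map_isZero hZ
    have := h₂.comm 0
    rw [dNext_eq h₂.hom (show (ComplexShape.up ℤ).Rel 0 1 by simp),
      prevD_eq h₂.hom (show (ComplexShape.up ℤ).Rel (-1) 0 by simp),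
      z.eq_of_src (h₂.hom 1 0) 0, comp_zero, zero_add] at this
    exact ⟨_, this⟩
  obtain ⟨t, e₂⟩ := e₂
  let S : ShortComplex A := ShortComplex.mk (Z.d (-1) 0) (s.f 0) (by
    rw [← s.comm, (HomologicalComplex.isZero_single_obj_X (ComplexShape.up ℤ) 0 X (-1)
      (by lia)).eq_of_tgt (s.f (-1)) 0, zero_comp])
  have hp : Epi (F.map (s.f 0)) := epi_of_epi_fac e₁
  -- by `e₁` and `e₂`, `F s⁰` is a cokernel of `F Z⁻¹ ⟶ F Z⁰`
  have key {W : B} (f : F.obj (Z.X 0) ⟶ W) (hf : F.map (Z.d (-1) 0) ≫ f = 0) :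
      F.map (s.f 0) ≫ g₀ ≫ f = f := by
    rw [reassoc_of% e₂, add_comp, assoc, hf, comp_zero, zero_add, id_comp]
  have hS : S.Exact := by
    rw [← S.exact_map_iff_of_faithful F]
    have : Epi (S.map F).g := hp
    exact ShortComplex.exact_of_g_is_cokernel _ (CokernelCofork.IsColimit.ofπ' _ _
      (fun {W} f hf => ⟨g₀ ≫ (show F.obj (Z.X 0) ⟶ W from f), key f hf⟩))
  have : Epi S.g := F.epi_of_epi_map hp
  have hf : S.f ≫ f.f 0 = 0 := by
    change Z.d (-1) 0 ≫ f.f 0 = 0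
    rw [← f.comm, (HomologicalComplex.isZero_single_obj_X (ComplexShape.up ℤ) 0 Y (-1)
      (by lia)).eq_of_tgt (f.f (-1)) 0, zero_comp]
  have hd : s.f 0 ≫ hS.desc (f.f 0) hf = f.f 0 := hS.g_desc _ hf
  let a : X ⟶ Y := (HomologicalComplex.singleObjXSelf (ComplexShape.up ℤ) 0 X).inv ≫
    hS.desc (f.f 0) hf ≫ (HomologicalComplex.singleObjXSelf (ComplexShape.up ℤ) 0 Y).hom
  refine ⟨a, HomologicalComplex.to_single_hom_ext ?_⟩
  rw [HomologicalComplex.comp_f, HomologicalComplex.single_map_f_self]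
  simp [a, hd]

instance : (singleDF F).Full where
  map_surjective {X Y} g := by
    obtain ⟨φ, hφ⟩ := Localization.exists_rightFraction (DF.Q F) (splitAcyclic F).trW g
    obtain ⟨Z, s, hs, f, rfl⟩ := φ.cases
    obtain ⟨Z, rfl⟩ : ∃ Z' : CochainComplex A ℤ, Z = (HomotopyCategory.quotient A _).obj Z' :=
      ⟨_, (HomotopyCategory.quotient_obj_surjective Z).choose_spec.symm⟩
    obtain ⟨s, rfl⟩ := (HomotopyCategory.quotient A _).map_surjective s
    obtain ⟨f, rfl⟩ := (HomotopyCategory.quotient A _).map_surjective f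
    have hZ (k : ℤ) (hk : 0 < k) : IsSplitExactAt ((F.mapHomologicalComplex _).obj Z) k :=
      (isSplitExactAt_iff_of_trW _ hs k).2
        ⟨0, 0, (isZero_map_single_X F X k (by lia)).eq_of_src _ _⟩
    have hι := trW_ιTruncLE Z 0 hZ
    obtain ⟨a, ha⟩ := exists_single_map_eq F X Y (Z.truncLE 0)
      ((Z.truncLE 0).isZero_of_isStrictlyLE 0 1) (Z.ιTruncLE 0 ≫ s) (by
        rw [Functor.map_comp]
        exact (splitAcyclic F).trW.comp_mem _ _ hι hs) (Z.ιTruncLE 0 ≫ f)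
    refine ⟨a, ?_⟩
    have h₁ := Localization.inverts (DF.Q F) (splitAcyclic F).trW _ hι
    have h₂ := Localization.inverts (DF.Q F) (splitAcyclic F).trW _ hs
    rw [hφ, ← cancel_epi ((DF.Q F).map ((HomotopyCategory.quotient A _).map s)),
      ← cancel_epi ((DF.Q F).map ((HomotopyCategory.quotient A _).map (Z.ιTruncLE 0))),
      MorphismProperty.RightFraction.map_s_comp_map (L := DF.Q F) (.mk _ hs _)]
    have := congr_arg (fun f => (DF.Q F).map ((HomotopyCategory.quotient A _).map f)) ha
    simpa using this

end Single

/-! ### Morphisms to bounded complexes of relative injectives -/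

section Injective

variable {A : Type u₁} [Category.{v₁} A] [Abelian A] {B : Type u₂} [Category.{v₂} B] [Abelian B]
  {L R : B ⥤ A} {F : A ⥤ B} [F.Additive]

/-- A morphism from an `F`-split exact complex to an `F`-injective object extends along
the differential. -/
lemma exists_extension (adj : F ⊣ R) {I : A} (hI : IsSummandOfImage R I) (S : CochainComplex A ℤ)
    (n m k : ℤ) (hn : n + 1 = m) (hk : m + 1 = k)
    (hS : IsSplitExactAt ((F.mapHomologicalComplex _).obj S) m)
    (f : S.X m ⟶ I) (hf : S.d n m ≫ f = 0) : ∃ h : S.X k ⟶ I, S.d m k ≫ h = f := by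
  obtain ⟨Y, ⟨e⟩⟩ := hI
  obtain ⟨s, s', hs⟩ : ∃ (s : F.obj (S.X m) ⟶ F.obj (S.X n)) (s' : F.obj (S.X k) ⟶ F.obj (S.X m)),
      s ≫ F.map (S.d n m) + F.map (S.d m k) ≫ s' = 𝟙 _ :=
    (isSplitExactAt_iff _ n m k hn hk).1 hS
  let g : F.obj (S.X m) ⟶ Y := (adj.homEquiv _ _).symm (f ≫ e.i)
  have hg : F.map (S.d n m) ≫ g = 0 := by
    rw [← Adjunction.homEquiv_naturality_left_symm, reassoc_of% hf, zero_comp,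
      Adjunction.homEquiv_counit, F.map_zero, zero_comp]
  have hg' : F.map (S.d m k) ≫ s' ≫ g = g := by
    have := hs =≫ g
    rwa [add_comp, assoc, hg, comp_zero, zero_add, id_comp, assoc] at this
  refine ⟨adj.homEquiv _ _ (s' ≫ g) ≫ e.r, ?_⟩
  rw [← assoc, ← Adjunction.homEquiv_naturality_left, hg']
  simp [g]

lemma isSplitExactAt_of_splitAcyclic {S : CochainComplex A ℤ}
    (hS : splitAcyclic F ((HomotopyCategory.quotient A _).obj S)) (m : ℤ) :
    IsSplitExactAt ((F.mapHomologicalComplex _).obj S) m := by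
  refine IsSplitExactAt.of_homotopy (K := 0) ⟨0, 0, ?_⟩ 0 0
    (HomotopyCategory.homotopyOfEq _ _ (IsZero.eq_of_src hS _ _))
  exact ((HomologicalComplex.eval B (ComplexShape.up ℤ) m).map_isZero
    (isZero_zero _)).eq_of_src _ _

/-- Morphisms from `F`-split acyclic complexes to bounded complexes of `F`-injectives vanish
in the homotopy category. -/
lemma homotopyProj_le_rightOrthogonal (adj : F ⊣ R) :
    homotopyProj R ≤ (splitAcyclic F).rightOrthogonal := by
  rintro X ⟨P, ⟨hP, a, b, hb⟩, ⟨e⟩⟩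
  refine ObjectProperty.prop_of_iso _ e ?_
  intro S f hS
  obtain ⟨S, rfl⟩ := HomotopyCategory.quotient_obj_surjective S
  obtain ⟨f, rfl⟩ := (HomotopyCategory.quotient _ _).map_surjective f
  -- by induction, `f` is homotopic to a morphism vanishing in more and more degrees from below
  have key (k : ℕ) : ∀ f : S ⟶ P, (∀ n : ℤ, n ≤ b - k → f.f n = 0) →
      (HomotopyCategory.quotient A (ComplexShape.up ℤ)).map f = 0 := by
    induction k with
    | zero =>
      intro f hf
      have : f = 0 := by
        ext n
        by_cases hn : b < n
        · exact (hb n (Or.inr hn)).eq_of_tgt _ _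
        · exact hf n (by lia)
      rw [this, Functor.map_zero]
    | succ k ih =>
      intro f hf
      obtain ⟨h, hh⟩ := exists_extension adj (hP (b - k)) S (b - k - 1) (b - k) (b - k + 1)
        (by lia) rfl (isSplitExactAt_of_splitAcyclic hS _) (f.f (b - k)) (by
          rw [← f.comm, hf (b - k - 1) (by push_cast; lia), zero_comp])
      let h' : ∀ i j : ℤ, (ComplexShape.up ℤ).Rel j i → (S.X i ⟶ P.X j) := fun i j hij =>
        if hj : j = b - k then
          (S.XIsoOfEq (show i = b - k + 1 by simp at hij; lia)).hom ≫ h ≫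
            (P.XIsoOfEq hj.symm).hom else 0
      have h0 : (HomotopyCategory.quotient A (ComplexShape.up ℤ)).map
          (Homotopy.nullHomotopicMap' h') = 0 := by
        rw [← Functor.map_zero]
        exact HomotopyCategory.eq_of_homotopy _ _ (Homotopy.nullHomotopy' h')
      have h1 := ih (f - Homotopy.nullHomotopicMap' h') (fun n hn => by
        rw [HomologicalComplex.sub_f_apply, Homotopy.nullHomotopicMap'_f
          (k₂ := n - 1) (k₁ := n) (k₀ := n + 1) (by simp) (by simp)]
        obtain rfl | hn' := hn.eq_or_lt
        · simp [h', hh]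
        · have e1 : ¬ n = b - k := by lia
          have e2 : ¬ n - 1 = b - k := by lia
          simp [h', e1, e2, hf n (by push_cast; lia)])
      rwa [Functor.map_sub, h0, sub_zero] at h1
  refine key (b + 1 - a).toNat f (fun n hn => ?_)
  exact (hb n (Or.inl (by lia))).eq_of_tgt _ _

lemma homotopyProj_le_rightOrthogonal_of_isFrobenius (t : Adjunction.Triple L F R)
    [IsFrobenius t] : homotopyProj L ≤ (splitAcyclic F).rightOrthogonal := by
  refine le_trans ?_ (homotopyProj_le_rightOrthogonal t.adj₂)
  rintro X ⟨P, ⟨hP, hb⟩, e⟩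
  exact ⟨P, ⟨fun n => (IsFrobenius.projective_iff_injective (t := t) _).1 (hP n), hb⟩, e⟩

end Injective

/-! ### Brutal truncation -/

section BrutalTruncation

variable {A : Type u₁} [Category.{v₁} A] [Abelian A] {B : Type u₂} [Category.{v₂} B] [Abelian B]
  {L : B ⥤ A}

/-- Killing the lowest term of a complex of relative projectives: a morphism from a complex
concentrated in degree zero factors through the brutal truncation when that term has negative
degree. -/
lemma exists_factorization_of_isZero_lt (P : CochainComplex A ℤ) (hP : boundedProj L P)
    {X : A} (a : ℤ) (ha : a < 0) (hPa : ∀ n, n < a → IsZero (P.X n))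
    (φ : (HomologicalComplex.single A (ComplexShape.up ℤ) 0).obj X ⟶ P) :
    ∃ (P' : CochainComplex A ℤ) (_ : boundedProj L P') (_ : ∀ n, n < a + 1 → IsZero (P'.X n))
      (i : P' ⟶ P) (φ' : (HomologicalComplex.single A (ComplexShape.up ℤ) 0).obj X ⟶ P'),
      φ' ≫ i = φ := by
  let π : P ⟶ (HomologicalComplex.single A (ComplexShape.up ℤ) a).obj (P.X a) :=
    HomologicalComplex.mkHomToSingle (𝟙 _) (fun i hi =>
      (hPa i (by have : i + 1 = a := hi; lia)).eq_of_src _ _)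
  have hπ : IsIso (π.f a) := by
    dsimp only [π]
    rw [HomologicalComplex.mkHomToSingle_f]
    infer_instance
  let S : ShortComplex (CochainComplex A ℤ) := ShortComplex.mk (kernel.ι π) π (by simp)
  have hS : S.Exact := ShortComplex.exact_of_f_is_kernel _ (kernelIsKernel π)
  have hSn (n : ℤ) := hS.map (HomologicalComplex.eval A (ComplexShape.up ℤ) n)
  have hz : IsZero ((kernel π).X a) := by
    have h : (kernel.ι π).f a ≫ π.f a = 0 := by
      rw [← HomologicalComplex.comp_f, kernel.condition, HomologicalComplex.zero_f]
    rw [IsZero.iff_id_eq_zero, ← cancel_mono ((kernel.ι π).f a), ← cancel_mono (π.f a), assoc,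
      assoc, h]
    simp
  have hiso (n : ℤ) (hn : n ≠ a) : IsIso ((kernel.ι π).f n) := by
    have h0 := (HomologicalComplex.isZero_single_obj_X (ComplexShape.up ℤ) a (P.X a) n hn)
    have : Epi ((kernel.ι π).f n) :=
      ((S.map (HomologicalComplex.eval A (ComplexShape.up ℤ) n)).exact_iff_epi
        (h0.eq_of_tgt _ _)).1 (hSn n)
    exact isIso_of_mono_of_epi _
  have hzero (n : ℤ) (h : IsZero (P.X n)) : IsZero ((kernel π).X n) := by
    rw [IsZero.iff_id_eq_zero, ← cancel_mono ((kernel.ι π).f n)]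
    exact h.eq_of_tgt _ _
  obtain ⟨hP, b, c, hb⟩ := hP
  refine ⟨kernel π, ⟨fun n => ?_, b, c, fun n hn => hzero n (hb n hn)⟩, fun n hn => ?_,
    kernel.ι π, kernel.lift π φ ?_, kernel.lift_ι _ _ _⟩
  · by_cases hn : n = a
    · subst hn
      exact .of_isZero L hz
    · have := hiso n hn
      exact (hP n).of_retract L (Retract.ofIso (asIso ((kernel.ι π).f n)))
  · obtain rfl | hn := eq_or_ne n a
    · exact hz
    · exact hzero n (hPa n (by lia))
  · refine HomologicalComplex.to_single_hom_ext ?_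
    exact (HomologicalComplex.isZero_single_obj_X (ComplexShape.up ℤ) 0 X a
      (by lia)).eq_of_src _ _

/-- A morphism from an object in degree zero to a bounded complex of relative projectives factors
through such a complex concentrated in nonnegative degrees. -/
lemma exists_factorization_nonneg (P : CochainComplex A ℤ) (hP : boundedProj L P) {X : A}
    (φ : (HomologicalComplex.single A (ComplexShape.up ℤ) 0).obj X ⟶ P) :
    ∃ (P' : CochainComplex A ℤ) (_ : boundedProj L P') (_ : ∀ n, n < 0 → IsZero (P'.X n))
      (i : P' ⟶ P) (φ' : (HomologicalComplex.single A (ComplexShape.up ℤ) 0).obj X ⟶ P'),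
      φ' ≫ i = φ := by
  have key (k : ℕ) : ∀ (P : CochainComplex A ℤ) (_ : boundedProj L P)
      (_ : ∀ n : ℤ, n < -k → IsZero (P.X n))
      (φ : (HomologicalComplex.single A (ComplexShape.up ℤ) 0).obj X ⟶ P),
      ∃ (P' : CochainComplex A ℤ) (_ : boundedProj L P') (_ : ∀ n, n < 0 → IsZero (P'.X n))
        (i : P' ⟶ P) (φ' : (HomologicalComplex.single A (ComplexShape.up ℤ) 0).obj X ⟶ P'),
        φ' ≫ i = φ := by
    induction k with
    | zero => exact fun P hP h φ => ⟨P, hP, by simpa using h, 𝟙 _, φ, by simp⟩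
    | succ k ih =>
      intro P hP h φ
      obtain ⟨P', hP', h', i, φ', rfl⟩ :=
        exists_factorization_of_isZero_lt P hP (-(k + 1 : ℕ)) (by lia) h φ
      obtain ⟨P'', hP'', h'', i', φ'', rfl⟩ := ih P' hP' (fun n hn => h' n (by lia)) φ'
      exact ⟨P'', hP'', h'', i' ≫ i, φ'', by simp⟩
  obtain ⟨a, b, hab⟩ := hP.2
  exact key (-a).toNat P hP (fun n hn => hab n (Or.inl (by lia))) φ

end BrutalTruncation

/-! ### Full faithfulness of the comparison functor -/

section FullyFaithful

variable {A : Type u₁} [Category.{v₁} A] [Abelian A] {B : Type u₂} [Category.{v₂} B] [Abelian B]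
  {L R : B ⥤ A} {F : A ⥤ B}

omit [Abelian A] [Abelian B] in
lemma preservesFiniteLimits_of_triple (t : Adjunction.Triple L F R) : PreservesFiniteLimits F :=
  have := t.adj₁.rightAdjoint_preservesLimits
  inferInstance

omit [Abelian A] [Abelian B] in
lemma preservesFiniteColimits_of_triple (t : Adjunction.Triple L F R) :
    PreservesFiniteColimits F :=
  have := t.adj₂.leftAdjoint_preservesColimits
  inferInstance

variable [F.Additive] (t : Adjunction.Triple L F R) [IsFrobenius t]

include t in
/-- Morphisms from objects in degree zero to bounded complexes of relative projectives are
represented by morphisms of complexes. -/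
lemma exists_hom_from_single {X : A} {P : CochainComplex A ℤ} (hP : boundedProj L P)
    (u : (singleDF F).obj X ⟶ (DF.Q F).obj ((HomotopyCategory.quotient A _).obj P)) :
    ∃ φ : (HomologicalComplex.single A (ComplexShape.up ℤ) 0).obj X ⟶ P,
      (DF.Q F).map ((HomotopyCategory.quotient A _).map φ) = u := by
  obtain ⟨φ, hφ⟩ := (ObjectProperty.rightOrthogonal.map_bijective_of_isTriangulated
    (homotopyProj_le_rightOrthogonal_of_isFrobenius t _ (ObjectProperty.prop_map_obj _ _ hP))
    (DF.Q F) ((HomotopyCategory.quotient A _).obj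
      ((HomologicalComplex.single A (ComplexShape.up ℤ) 0).obj X))).2 u
  obtain ⟨φ, rfl⟩ := (HomotopyCategory.quotient A _).map_surjective φ
  exact ⟨φ, hφ⟩

omit [IsFrobenius t] in
include t in
/-- Morphisms from bounded complexes of relative projectives are represented by morphisms of
complexes. -/
lemma exists_hom_of_boundedProj {P K : CochainComplex A ℤ} (hP : boundedProj L P)
    (u : (DF.Q F).obj ((HomotopyCategory.quotient A _).obj P) ⟶
      (DF.Q F).obj ((HomotopyCategory.quotient A _).obj K)) :
    ∃ φ : P ⟶ K, (DF.Q F).map ((HomotopyCategory.quotient A _).map φ) = u := by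
  obtain ⟨φ, hφ⟩ := (ObjectProperty.leftOrthogonal.map_bijective_of_isTriangulated
    (homotopyProj_le_leftOrthogonal t.adj₁ _ (ObjectProperty.prop_map_obj _ _ hP))
    (DF.Q F) ((HomotopyCategory.quotient A _).obj K)).2 u
  obtain ⟨φ, rfl⟩ := (HomotopyCategory.quotient A _).map_surjective φ
  exact ⟨φ, hφ⟩

lemma exists_iso_of_mem_map {Z : DF F} (hZ : ((homotopyProj L).map (DF.Q F)) Z) :
    ∃ (P : CochainComplex A ℤ) (_ : boundedProj L P),
      Nonempty ((DF.Q F).obj ((HomotopyCategory.quotient A _).obj P) ≅ Z) := by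
  obtain ⟨X, ⟨P, hP, ⟨e⟩⟩, ⟨e'⟩⟩ := hZ
  exact ⟨P, hP, ⟨(DF.Q F).mapIso e ≪≫ e'⟩⟩

variable {t} in
omit [IsFrobenius t] in
lemma isZero_Q_obj {X : DbF F} (hX : KProj t X) : IsZero ((KProj t).trW.Q.obj X) := by
  have h : (KProj t).trW (contractibleTriangle X).mor₂ :=
    ObjectProperty.trW.mk' (KProj t) (contractible_distinguished _) hX
  have := Localization.inverts (KProj t).trW.Q (KProj t).trW _ h
  exact (((KProj t).trW.Q).map_isZero (isZero_zero _)).of_iso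
    (@asIso _ _ _ _ _ this)

lemma homotopyProj_map_le : (homotopyProj L).map (DF.Q F) ≤ boundedDF F := by
  rintro Z hZ
  obtain ⟨P, ⟨hP, a, b, h⟩, ⟨e⟩⟩ := exists_iso_of_mem_map hZ
  refine (boundedDF F).prop_of_iso e
    (ObjectProperty.prop_map_obj _ _ ⟨a, b, fun n hn => ⟨0, 0, ?_⟩⟩)
  exact IsZero.eq_of_src (F.map_isZero (h n hn)) _ _

variable [F.Faithful]

/-- A morphism of `A` which factors in `D_F(A)` through a bounded complex `P` of relative
projectives factors in `A` through the degree zero term of `P`. -/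
lemma stableRel_zero_of_factorization {X Y : A} (f : X ⟶ Y) {Z : DF F}
    (hZ : ((homotopyProj L).map (DF.Q F)) Z) (u : (singleDF F).obj X ⟶ Z)
    (v : Z ⟶ (singleDF F).obj Y) (h : u ≫ v = (singleDF F).map f) : stableRel t f 0 := by
  obtain ⟨P, hP, ⟨e⟩⟩ := exists_iso_of_mem_map hZ
  obtain ⟨φ, hφ⟩ := exists_hom_from_single t hP (u ≫ e.inv)
  obtain ⟨ψ, hψ⟩ := exists_hom_of_boundedProj t hP (e.hom ≫ v)
  let a : X ⟶ P.X 0 := (HomologicalComplex.singleObjXSelf (ComplexShape.up ℤ) 0 X).inv ≫ φ.f 0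
  let b : P.X 0 ⟶ Y := ψ.f 0 ≫ (HomologicalComplex.singleObjXSelf (ComplexShape.up ℤ) 0 Y).hom
  have hab : (HomologicalComplex.single A (ComplexShape.up ℤ) 0).map (a ≫ b) = φ ≫ ψ := by
    refine HomologicalComplex.to_single_hom_ext ?_
    rw [HomologicalComplex.single_map_f_self]
    simp [a, b]
  refine ⟨P.X 0, hP.1 0, a, b, (singleDF F).map_injective ?_⟩
  rw [sub_zero, ← h]
  change (DF.Q F).map ((HomotopyCategory.quotient A _).map
    ((HomologicalComplex.single A (ComplexShape.up ℤ) 0).map (a ≫ b))) = _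
  rw [hab, Functor.map_comp, Functor.map_comp, hφ, hψ]
  simp

include t in
/-- A morphism in `D_F(A)` from an object `X` of `A` to the middle term of an extension of a
bounded complex of relative projectives by an object `Y` of `A` is the sum of a morphism induced
by a morphism in `A` and of a morphism which factors through a bounded complex of relative
projectives. -/
lemma exists_decomposition {X Y : A} {Z K : DF F} (s : (singleDF F).obj Y ⟶ Z)
    (p : Z ⟶ K) (w : K ⟶ ((singleDF F).obj Y)⟦(1 : ℤ)⟧)
    (hT : Triangle.mk s p w ∈ distTriang (DF F))
    (hK : ((homotopyProj L).map (DF.Q F)) K) (g : (singleDF F).obj X ⟶ Z) :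
    ∃ (a : X ⟶ Y) (K' : DF F) (_ : ((homotopyProj L).map (DF.Q F)) K')
      (x : (singleDF F).obj X ⟶ K') (y : K' ⟶ Z), g = (singleDF F).map a ≫ s + x ≫ y := by
  have := preservesFiniteLimits_of_triple t
  have := preservesFiniteColimits_of_triple t
  obtain ⟨P, hP, ⟨e⟩⟩ := exists_iso_of_mem_map hK
  obtain ⟨φ, hφ⟩ := exists_hom_from_single t hP (g ≫ p ≫ e.inv)
  obtain ⟨P', hP', hP'0, i, φ', rfl⟩ := exists_factorization_nonneg P hP φ
  let N := (HomologicalComplex.single A (ComplexShape.up ℤ) 0).obj Y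
  let e' : (DF.Q F).obj ((HomotopyCategory.quotient A _).obj (N⟦(1 : ℤ)⟧)) ≅
      ((singleDF F).obj Y)⟦(1 : ℤ)⟧ :=
    (DF.Q F).mapIso (((HomotopyCategory.quotient A (.up ℤ)).commShiftIso (1 : ℤ)).app N) ≪≫
      ((DF.Q F).commShiftIso (1 : ℤ)).app _
  let j := (DF.Q F).map ((HomotopyCategory.quotient A _).map i) ≫ e.hom
  -- a complex in nonnegative degrees has no nonzero morphism to an object in degree `-1`
  have hj : j ≫ w = 0 := by
    obtain ⟨ψ, hψ⟩ := exists_hom_of_boundedProj t hP' (K := N⟦(1 : ℤ)⟧) (j ≫ w ≫ e'.inv)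
    have : ψ = 0 := by
      ext n
      by_cases hn : n < 0
      · exact (hP'0 n hn).eq_of_src _ _
      · exact (HomologicalComplex.isZero_single_obj_X (ComplexShape.up ℤ) 0 Y (n + 1)
          (by lia)).eq_of_tgt _ _
    rw [this, Functor.map_zero, Functor.map_zero] at hψ
    rw [← cancel_mono e'.inv, assoc, ← hψ, zero_comp]
  obtain ⟨y, hy⟩ : ∃ y : (DF.Q F).obj ((HomotopyCategory.quotient A _).obj P') ⟶ Z, j = y ≫ p :=
    Triangle.coyoneda_exact₂ _ (rot_of_distTriang _ hT) j hj
  let x : (singleDF F).obj X ⟶ (DF.Q F).obj ((HomotopyCategory.quotient A _).obj P') :=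
    (DF.Q F).map ((HomotopyCategory.quotient A _).map φ')
  have hxy : (g - x ≫ y) ≫ p = 0 := by
    rw [sub_comp, assoc, ← hy, sub_eq_zero, ← cancel_mono e.inv, assoc, ← hφ]
    simp [x, j]
  obtain ⟨c, hc⟩ : ∃ c : (singleDF F).obj X ⟶ (singleDF F).obj Y, g - x ≫ y = c ≫ s :=
    Triangle.coyoneda_exact₂ _ hT (g - x ≫ y) hxy
  obtain ⟨a, rfl⟩ := (singleDF F).map_surjective c
  refine ⟨a, _, ObjectProperty.prop_map_obj _ _ (ObjectProperty.prop_map_obj _ _ hP'), x, y, ?_⟩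
  rw [← hc]
  abel

/-- A morphism of `A` which vanishes in `D^b_F(A)/K(P)` factors through a relatively projective
object: it is annihilated by a morphism with cone in `K(P)`, so that it factors through an object
of `K(P)`. -/
lemma stableRel_zero_of_map_eq_zero {X Y : A} (f : X ⟶ Y)
    (hf : (singleDbF F ⋙ (KProj t).trW.Q).map f = 0) : stableRel t f 0 := by
  have h : (KProj t).trW.Q.map ((singleDbF F).map f) = (KProj t).trW.Q.map 0 := by
    rw [Functor.map_zero]
    exact hf
  rw [MorphismProperty.map_eq_iff_postcomp (KProj t).trW.Q (KProj t).trW] at h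
  obtain ⟨Z, s, hs, eq⟩ := h
  rw [ObjectProperty.trW_iff'] at hs
  obtain ⟨K, k, w, hT, hK⟩ := hs
  rw [zero_comp] at eq
  obtain ⟨u, hu⟩ := Triangle.coyoneda_exact₂ _ hT _ eq
  refine stableRel_zero_of_factorization t f hK ((boundedDF F).ι.map u) ((boundedDF F).ι.map k) ?_
  exact ((boundedDF F).ι.map_comp u k).symm.trans ((boundedDF F).ι.congr_map hu).symm

instance : (comparison t).Faithful where
  map_injective {X Y f g} h := by
    obtain ⟨f, rfl⟩ := (Stable.proj t).map_surjective f
    obtain ⟨g, rfl⟩ := (Stable.proj t).map_surjective g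
    refine CategoryTheory.Quotient.sound _ ?_
    obtain ⟨P, hP, a, b, e⟩ := stableRel_zero_of_map_eq_zero t (f - g) (by
      rw [Functor.map_sub, sub_eq_zero]
      exact h)
    exact ⟨P, hP, a, b, by rw [e, sub_zero]⟩

instance : (comparison t).Full where
  map_surjective {X Y} g := by
    obtain ⟨X⟩ := X
    obtain ⟨Y⟩ := Y
    obtain ⟨φ, hφ⟩ := Localization.exists_leftFraction (KProj t).trW.Q (KProj t).trW
      (X := (singleDbF F).obj X) (Y := (singleDbF F).obj Y) g
    obtain ⟨Z, f, s, hs, rfl⟩ := φ.cases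
    have hs' := hs
    obtain ⟨K, p, w, hT, hK⟩ := hs'
    have hT' := (boundedDF F).ι.map_distinguished _ hT
    obtain ⟨a, K', hK', x, y, h⟩ := exists_decomposition t (X := X) (Y := Y)
      ((boundedDF F).ι.map s) ((boundedDF F).ι.map p) _ hT' hK ((boundedDF F).ι.map f)
    -- the factorization through `K'` takes place in `D^b_F(A)`, and vanishes in the quotient
    let K'' : DbF F := ⟨K', homotopyProj_map_le _ hK'⟩
    let x' : (singleDbF F).obj X ⟶ K'' := (boundedDF F).homMk x
    let y' : K'' ⟶ Z := (boundedDF F).homMk y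
    have h' : f = (singleDbF F).map a ≫ s + x' ≫ y' := (boundedDF F).ι.map_injective h
    have hx : (KProj t).trW.Q.map (x' ≫ y') = 0 := by
      rw [Functor.map_comp, (isZero_Q_obj (t := t) (X := K'') hK').eq_of_tgt
        ((KProj t).trW.Q.map x') 0, zero_comp]
    refine ⟨(Stable.proj t).map a, ?_⟩
    have := Localization.inverts (KProj t).trW.Q (KProj t).trW _ hs
    rw [hφ]
    refine (cancel_mono ((KProj t).trW.Q.map s)).1 ?_
    refine Eq.trans ?_ (MorphismProperty.LeftFraction.map_comp_map_s (L := (KProj t).trW.Q)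
      (.mk f s hs) _).symm
    refine ((KProj t).trW.Q.map_comp _ _).symm.trans ?_
    change _ = (KProj t).trW.Q.map f
    rw [h', Functor.map_add, hx, add_zero]

end FullyFaithful

/-! ### Connecting morphisms of relatively split sequences -/

section Connecting

variable {A : Type u₁} [Category.{v₁} A] [Abelian A]
  {D : Type*} [Category* D] [HasShift D ℤ]
  (Q : HomotopyCategory A (ComplexShape.up ℤ) ⥤ D) [Q.CommShift ℤ]

/-- The third morphism of the standard triangle of a morphism of complexes. -/
def mappingConeδ {K L : CochainComplex A ℤ} (φ : K ⟶ L) :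
    (HomotopyCategory.quotient A (ComplexShape.up ℤ)).obj (mappingCone φ) ⟶
      ((HomotopyCategory.quotient A (ComplexShape.up ℤ)).obj K)⟦(1 : ℤ)⟧ :=
  (mappingCone.triangleh φ).mor₃

/-- The connecting morphism of a sequence of complexes `S`, in a category where the canonical
morphism from the mapping cone of `S.f` to `S.X₃` is inverted. -/
def connectingHom (S : ShortComplex (CochainComplex A ℤ))
    (hS : IsIso (Q.map ((HomotopyCategory.quotient A _).map (mappingCone.descShortComplex S)))) :
    Q.obj ((HomotopyCategory.quotient A _).obj S.X₃) ⟶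
      (Q.obj ((HomotopyCategory.quotient A _).obj S.X₁))⟦(1 : ℤ)⟧ :=
  inv (Q.map ((HomotopyCategory.quotient A _).map (mappingCone.descShortComplex S))) ≫
    Q.map (mappingConeδ S.f) ≫ (Q.commShiftIso (1 : ℤ)).hom.app _

lemma connectingHom_naturality {S₁ S₂ : ShortComplex (CochainComplex A ℤ)} (f : S₁ ⟶ S₂)
    (hS₁ : IsIso (Q.map ((HomotopyCategory.quotient A _).map (mappingCone.descShortComplex S₁))))
    (hS₂ : IsIso (Q.map ((HomotopyCategory.quotient A _).map (mappingCone.descShortComplex S₂)))) :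
    connectingHom Q S₁ hS₁ ≫ (Q.map ((HomotopyCategory.quotient A _).map f.τ₁))⟦(1 : ℤ)⟧' =
      Q.map ((HomotopyCategory.quotient A _).map f.τ₃) ≫ connectingHom Q S₂ hS₂ := by
  have h₁ : Q.map ((HomotopyCategory.quotient A _).map (mappingCone.descShortComplex S₁)) ≫
      Q.map ((HomotopyCategory.quotient A _).map f.τ₃) =
      Q.map ((HomotopyCategory.quotient A _).map
        (mappingCone.map S₁.f S₂.f f.τ₁ f.τ₂ f.comm₁₂.symm)) ≫
      Q.map ((HomotopyCategory.quotient A _).map (mappingCone.descShortComplex S₂)) := by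
    simp only [← Functor.map_comp, mappingCone.map_descShortComplex]
  have h₂ : mappingConeδ S₁.f ≫
      ((HomotopyCategory.quotient A _).map f.τ₁)⟦(1 : ℤ)⟧' =
      (HomotopyCategory.quotient A _).map
        (mappingCone.map S₁.f S₂.f f.τ₁ f.τ₂ f.comm₁₂.symm) ≫ mappingConeδ S₂.f :=
    ((HomotopyCategory.quotient A (ComplexShape.up ℤ)).mapTriangle.map
      (mappingCone.triangleMap S₁.f S₂.f f.τ₁ f.τ₂ f.comm₁₂.symm)).comm₃
  have h₃ := Q.commShiftIso_hom_naturality ((HomotopyCategory.quotient A _).map f.τ₁) (1 : ℤ)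
  rw [← cancel_epi (Q.map ((HomotopyCategory.quotient A _).map
    (mappingCone.descShortComplex S₁))), reassoc_of% h₁]
  dsimp only [connectingHom]
  rw [assoc, IsIso.hom_inv_id_assoc, IsIso.hom_inv_id_assoc, assoc, ← h₃, ← Functor.map_comp_assoc,
    h₂, Functor.map_comp_assoc]

lemma connectingHom_distinguished [HasZeroObject D] [Preadditive D]
    [∀ n : ℤ, (shiftFunctor D n).Additive] [Pretriangulated D] [Q.IsTriangulated]
    (S : ShortComplex (CochainComplex A ℤ))
    (hS : IsIso (Q.map ((HomotopyCategory.quotient A _).map (mappingCone.descShortComplex S)))) :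
    Triangle.mk (Q.map ((HomotopyCategory.quotient A _).map S.f))
      (Q.map ((HomotopyCategory.quotient A _).map S.g)) (connectingHom Q S hS) ∈ distTriang D := by
  refine isomorphic_distinguished _
    (Q.map_distinguished _ (HomotopyCategory.mappingCone_triangleh_distinguished S.f)) _
    (Iso.symm (Triangle.isoMk _ _ (Iso.refl _) (Iso.refl _) (@asIso _ _ _ _ _ hS) ?_ ?_ ?_))
  · exact (comp_id _).trans (id_comp _).symm
  · refine Eq.trans ?_ (id_comp _).symm
    change Q.map ((HomotopyCategory.quotient A _).map (mappingCone.inr S.f)) ≫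
      Q.map ((HomotopyCategory.quotient A _).map (mappingCone.descShortComplex S)) =
      Q.map ((HomotopyCategory.quotient A _).map S.g)
    rw [← Functor.map_comp, ← Functor.map_comp, mappingCone.inr_descShortComplex]
  · refine Eq.trans ?_ (IsIso.hom_inv_id_assoc (Q.map ((HomotopyCategory.quotient A _).map
      (mappingCone.descShortComplex S))) _).symm
    refine Eq.trans ?_ (comp_id _)
    exact congr_arg _ ((shiftFunctor D (1 : ℤ)).map_id _)

end Connecting

section SplitSequence

variable {A : Type u₁} [Category.{v₁} A] [Abelian A] {B : Type u₂} [Category.{v₂} B] [Abelian B]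
  (F : A ⥤ B) [F.Additive]

/-- For an `F`-split sequence in `A`, placed in degree zero, the canonical morphism from the
mapping cone is inverted in `D_F(A)`. -/
lemma isIso_descShortComplex_single (S : ShortComplex A) (σ : Nonempty (S.map F).Splitting) :
    IsIso ((DF.Q F).map ((HomotopyCategory.quotient A _).map (mappingCone.descShortComplex
      (S.map (HomologicalComplex.single A (ComplexShape.up ℤ) 0))))) := by
  refine Localization.inverts (DF.Q F) (splitAcyclic F).trW _
    (trW_descShortComplex _ (fun n => σ.map (fun s => ?_)))
  let G := HomologicalComplex.single B (ComplexShape.up ℤ) 0 ⋙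
    HomologicalComplex.eval B (ComplexShape.up ℤ) n
  let e : F ⋙ G ≅ HomologicalComplex.single A (ComplexShape.up ℤ) 0 ⋙
      F.mapHomologicalComplex (ComplexShape.up ℤ) ⋙
      HomologicalComplex.eval B (ComplexShape.up ℤ) n :=
    Functor.isoWhiskerRight
      (HomologicalComplex.singleMapHomologicalComplex F (ComplexShape.up ℤ) 0).symm
      (HomologicalComplex.eval B (ComplexShape.up ℤ) n)
  exact (s.map G).ofIso (S.mapNatIso e)

/-- The connecting morphism in `D_F(A)` of an `F`-split sequence in `A`. -/
def splitδDF (S : ShortComplex A) (σ : Nonempty (S.map F).Splitting) :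
    (singleDF F).obj S.X₃ ⟶ ((singleDF F).obj S.X₁)⟦(1 : ℤ)⟧ :=
  connectingHom (DF.Q F) _ (isIso_descShortComplex_single F S σ)

/-- The connecting morphism in `D^b_F(A)` of an `F`-split sequence in `A`. -/
def splitδ (S : ShortComplex A) (σ : Nonempty (S.map F).Splitting) :
    (singleDbF F).obj S.X₃ ⟶ ((singleDbF F).obj S.X₁)⟦(1 : ℤ)⟧ :=
  (boundedDF F).fullyFaithfulι.preimage (splitδDF F S σ ≫
    ((boundedDF F).ι.commShiftIso (1 : ℤ)).inv.app ((singleDbF F).obj S.X₁))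

lemma map_splitδ (S : ShortComplex A) (σ : Nonempty (S.map F).Splitting) :
    (boundedDF F).ι.map (splitδ F S σ) = splitδDF F S σ ≫
      ((boundedDF F).ι.commShiftIso (1 : ℤ)).inv.app ((singleDbF F).obj S.X₁) :=
  (boundedDF F).fullyFaithfulι.map_preimage _

lemma splitδ_distinguished (S : ShortComplex A) (σ : Nonempty (S.map F).Splitting) :
    Triangle.mk ((singleDbF F).map S.f) ((singleDbF F).map S.g) (splitδ F S σ) ∈
      distTriang (DbF F) := by
  have h := connectingHom_distinguished (DF.Q F) _ (isIso_descShortComplex_single F S σ)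
  have e : (boundedDF F).ι.map (splitδ F S σ) ≫
      ((boundedDF F).ι.commShiftIso (1 : ℤ)).hom.app ((singleDbF F).obj S.X₁) = splitδDF F S σ := by
    rw [map_splitδ, assoc, Iso.inv_hom_id_app]
    exact comp_id _
  refine isomorphic_distinguished _ h ((boundedDF F).ι.mapTriangle.obj (Triangle.mk
    ((singleDbF F).map S.f) ((singleDbF F).map S.g) (splitδ F S σ))) ?_
  refine Triangle.isoMk _ _ (Iso.refl _) (Iso.refl _) (Iso.refl _) ?_ ?_ ?_
  · exact (comp_id _).trans (id_comp _).symm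
  · exact (comp_id _).trans (id_comp _).symm
  · refine Eq.trans ?_ (id_comp _).symm
    refine Eq.trans (congr_arg _ ((shiftFunctor (DF F) (1 : ℤ)).map_id _)) ?_
    exact (comp_id _).trans e

lemma splitδDF_naturality {S₁ S₂ : ShortComplex A} (f : S₁ ⟶ S₂)
    (σ₁ : Nonempty (S₁.map F).Splitting) (σ₂ : Nonempty (S₂.map F).Splitting) :
    splitδDF F S₁ σ₁ ≫ ((singleDF F).map f.τ₁)⟦(1 : ℤ)⟧' =
      (singleDF F).map f.τ₃ ≫ splitδDF F S₂ σ₂ :=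
  connectingHom_naturality (DF.Q F)
    ((HomologicalComplex.single A (ComplexShape.up ℤ) 0).mapShortComplex.map f) _ _

lemma splitδ_naturality {S₁ S₂ : ShortComplex A} (f : S₁ ⟶ S₂)
    (σ₁ : Nonempty (S₁.map F).Splitting) (σ₂ : Nonempty (S₂.map F).Splitting) :
    splitδ F S₁ σ₁ ≫ ((singleDbF F).map f.τ₁)⟦(1 : ℤ)⟧' =
      (singleDbF F).map f.τ₃ ≫ splitδ F S₂ σ₂ := by
  refine (boundedDF F).ι.map_injective ?_
  have h := splitδDF_naturality F f σ₁ σ₂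
  have h' := (boundedDF F).ι.commShiftIso_inv_naturality ((singleDbF F).map f.τ₁) (1 : ℤ)
  rw [Functor.map_comp, Functor.map_comp, map_splitδ, map_splitδ, assoc]
  refine (congr_arg _ h').symm.trans ?_
  refine (assoc _ _ _).symm.trans ((congr_arg (· ≫ _) h).trans (assoc _ _ _))

end SplitSequence

/-! ### The suspension and the shift -/

section Hull

variable {A : Type u₁} [Category.{v₁} A] [Abelian A] {B : Type u₂} [Category.{v₂} B] [Abelian B]
  {L R : B ⥤ A} {F : A ⥤ B} (t : Adjunction.Triple L F R)

/-- The sequence `X ⟶ R F X ⟶ Ω_F⁻¹ X`. -/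
abbrev hull (X : A) : ShortComplex A :=
  ShortComplex.mk (t.adj₂.unit.app X) (cokernel.π (t.adj₂.unit.app X)) (cokernel.condition _)

omit [Abelian B] in
lemma π_cosyzygy_map {X Y : A} (f : X ⟶ Y) :
    cokernel.π (t.adj₂.unit.app X) ≫ (cosyzygy t).map f =
      R.map (F.map f) ≫ cokernel.π (t.adj₂.unit.app Y) :=
  cokernel.π_desc _ _ _

/-- The functoriality of the sequence `X ⟶ R F X ⟶ Ω_F⁻¹ X`. -/
abbrev hullMap {X Y : A} (f : X ⟶ Y) : hull t X ⟶ hull t Y where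
  τ₁ := f
  τ₂ := R.map (F.map f)
  τ₃ := (cosyzygy t).map f
  comm₁₂ := t.adj₂.unit.naturality f
  comm₂₃ := (π_cosyzygy_map t f).symm

omit [Abelian B] in
lemma hull_shortExact [F.Faithful] (X : A) : (hull t X).ShortExact :=
  ShortComplex.ShortExact.mk' (ShortComplex.exact_cokernel _)
    (inferInstanceAs (Mono (t.adj₂.unit.app X))) (inferInstanceAs (Epi (cokernel.π _)))

/-- A short exact sequence whose first morphism has a retraction after applying `F` is
`F`-split. -/
lemma nonempty_splitting_of_retraction [F.Additive] [PreservesFiniteLimits F]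
    [PreservesFiniteColimits F] {S : ShortComplex A} (hS : S.ShortExact)
    (r : F.obj S.X₂ ⟶ F.obj S.X₁) (hr : F.map S.f ≫ r = 𝟙 _) :
    Nonempty (S.map F).Splitting :=
  ⟨.ofExactOfRetraction _ (hS.map_of_exact F).exact r hr (hS.map_of_exact F).epi_g⟩

lemma nonempty_splitting_hull [F.Additive] [F.Faithful] (X : A) :
    Nonempty ((hull t X).map F).Splitting :=
  have := preservesFiniteLimits_of_triple t
  have := preservesFiniteColimits_of_triple t
  nonempty_splitting_of_retraction (hull_shortExact t X) (t.adj₂.counit.app (F.obj X))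
    (t.adj₂.left_triangle_components X)

omit [Abelian A] [Abelian B] in
lemma isFProjective_obj [IsFrobenius t] (Y : B) : IsFProjective t (R.obj Y) :=
  (IsFrobenius.projective_iff_injective (t := t) _).2 ⟨Y, ⟨Retract.refl _⟩⟩

variable [F.Additive]

variable {t} in
/-- The morphism from an `F`-split sequence to the hull sequence in a standard triangle. -/
abbrev StandardTriangle.toHull (E : StandardTriangle t) : E.S ⟶ hull t E.S.X₁ where
  τ₁ := 𝟙 _
  τ₂ := E.h
  τ₃ := E.w
  comm₁₂ := (id_comp _).trans E.f_h.symm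
  comm₂₃ := E.g_w.symm

/-- The functor from `A` to `D^b_F(A)/K(P)` which places an object in degree zero. -/
abbrev singleQ : A ⥤ DbFModKProj t := singleDbF F ⋙ (KProj t).trW.Q

/-- The connecting morphism in `D^b_F(A)/K(P)` of an `F`-split sequence. -/
def quotientδ (S : ShortComplex A) (σ : Nonempty (S.map F).Splitting) :
    (singleQ t).obj S.X₃ ⟶ ((singleQ t).obj S.X₁)⟦(1 : ℤ)⟧ :=
  (KProj t).trW.Q.map (splitδ F S σ) ≫
    ((KProj t).trW.Q.commShiftIso (1 : ℤ)).hom.app ((singleDbF F).obj S.X₁)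

lemma quotientδ_distinguished (S : ShortComplex A) (σ : Nonempty (S.map F).Splitting) :
    Triangle.mk ((singleQ t).map S.f) ((singleQ t).map S.g) (quotientδ t S σ) ∈
      distTriang (DbFModKProj t) :=
  (KProj t).trW.Q.map_distinguished _ (splitδ_distinguished F S σ)

lemma quotientδ_naturality {S₁ S₂ : ShortComplex A} (f : S₁ ⟶ S₂)
    (σ₁ : Nonempty (S₁.map F).Splitting) (σ₂ : Nonempty (S₂.map F).Splitting) :
    quotientδ t S₁ σ₁ ≫ ((singleQ t).map f.τ₁)⟦(1 : ℤ)⟧' =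
      (singleQ t).map f.τ₃ ≫ quotientδ t S₂ σ₂ := by
  have h₁ := (KProj t).trW.Q.congr_map (splitδ_naturality F f σ₁ σ₂)
  have h₂ := (KProj t).trW.Q.commShiftIso_hom_naturality ((singleDbF F).map f.τ₁) (1 : ℤ)
  dsimp only [quotientδ]
  refine (assoc _ _ _).trans ((congr_arg _ h₂).symm.trans ?_)
  rw [Functor.map_comp, Functor.map_comp] at h₁
  exact (assoc _ _ _).symm.trans ((congr_arg (· ≫ _) h₁).trans (assoc _ _ _))

variable [F.Faithful] [IsFrobenius t]

lemma isIso_quotientδ_hull (X : A) :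
    IsIso (quotientδ t (hull t X) (nonempty_splitting_hull t X)) :=
  (Triangle.isZero₂_iff_isIso₃ _ (quotientδ_distinguished t (hull t X)
    (nonempty_splitting_hull t X))).1 (isZero_single_of_projective t (isFProjective_obj t _))

/-- The functor to `D^b_F(A)/K(P)` identifies `Ω_F⁻¹` with the shift. -/
def cosyzygySingleQIso : cosyzygy t ⋙ singleQ t ≅ singleQ t ⋙ shiftFunctor _ (1 : ℤ) :=
  NatIso.ofComponents (fun X => @asIso _ _ _ _ _ (isIso_quotientδ_hull t X))
    (fun f => (quotientδ_naturality t (hullMap t f) (nonempty_splitting_hull t _)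
      (nonempty_splitting_hull t _)).symm)

/-- The comparison functor identifies the suspension of the stable category with the shift. -/
def suspComparisonIso :
    Stable.susp t ⋙ comparison t ≅ comparison t ⋙ shiftFunctor _ (1 : ℤ) :=
  CategoryTheory.Quotient.natIsoLift _ (cosyzygySingleQIso t)

/-- The connecting morphism of the sequence of a standard triangle is induced by its third
morphism. -/
lemma quotientδ_standardTriangle (E : StandardTriangle t) :
    quotientδ t E.S E.split = (singleQ t).map E.w ≫ (cosyzygySingleQIso t).hom.app E.S.X₁ := by
  have h := quotientδ_naturality t E.toHull E.split (nonempty_splitting_hull t _)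
  refine Eq.trans ?_ h
  refine (comp_id _).symm.trans (congr_arg _ ?_)
  refine ((shiftFunctor _ (1 : ℤ)).map_id _).symm.trans (congr_arg _ ?_)
  exact ((singleQ t).map_id _).symm

end Hull

/-! ### Removing the highest degree of a complex -/

section ConeReduction

variable {A : Type u₁} [Category.{v₁} A] [Abelian A] {B : Type u₂} [Category.{v₂} B] [Abelian B]
  {L : B ⥤ A} {F : A ⥤ B} (adj : L ⊣ F)

/-- The morphism from a relatively projective object in degree `n` to a complex `K` whose image
under `F` hits all the cycles of `F K` in degree `n`. -/
def cyclesCover (K : CochainComplex A ℤ) (n : ℤ) :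
    (HomologicalComplex.single A (ComplexShape.up ℤ) n).obj
      (L.obj (F.obj (kernel (K.d n (n + 1))))) ⟶ K :=
  HomologicalComplex.mkHomFromSingle (adj.counit.app _ ≫ kernel.ι _) (fun k hk => by
    obtain rfl : n + 1 = k := hk
    rw [assoc, kernel.condition, comp_zero])

omit [Abelian B] in
/-- The image under `F` of the counit is a split epimorphism, so that the inclusion of the cycles
of `F K` factors through `cyclesCover`. -/
lemma exists_section_cyclesCover (K : CochainComplex A ℤ) (n : ℤ) :
    ∃ s : F.obj (kernel (K.d n (n + 1))) ⟶ F.obj (((HomologicalComplex.single A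
      (ComplexShape.up ℤ) n).obj (L.obj (F.obj (kernel (K.d n (n + 1)))))).X n),
      s ≫ F.map ((cyclesCover adj K n).f n) = F.map (kernel.ι (K.d n (n + 1))) := by
  refine ⟨adj.unit.app _ ≫ F.map (HomologicalComplex.singleObjXSelf (ComplexShape.up ℤ) n _).inv,
    ?_⟩
  dsimp only [cyclesCover]
  rw [HomologicalComplex.mkHomFromSingle_f, assoc, ← F.map_comp, Iso.inv_hom_id_assoc, F.map_comp,
    Adjunction.right_triangle_components_assoc]

variable [F.Additive] [PreservesFiniteLimits F]

/-- Passing to the cone of `cyclesCover` makes a complex split in its highest degree. -/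
lemma isSplitExactAt_mappingCone_cyclesCover (K : CochainComplex A ℤ) (n : ℤ)
    (hK : IsSplitExactAt ((F.mapHomologicalComplex _).obj K) (n + 1)) :
    IsSplitExactAt ((F.mapHomologicalComplex _).obj (mappingCone (cyclesCover adj K n))) n := by
  obtain ⟨s, s', hs⟩ : ∃ (s : F.obj (K.X (n + 1)) ⟶ F.obj (K.X n))
      (s' : F.obj (K.X (n + 2)) ⟶ F.obj (K.X (n + 1))),
      s ≫ F.map (K.d n (n + 1)) + F.map (K.d (n + 1) (n + 2)) ≫ s' = 𝟙 _ :=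
    (isSplitExactAt_iff _ n (n + 1) (n + 2) rfl (by lia)).1 hK
  obtain ⟨σ, hσ⟩ := exists_section_cyclesCover adj K n
  have hd : F.map (K.d n (n + 1)) ≫ s ≫ F.map (K.d n (n + 1)) = F.map (K.d n (n + 1)) := by
    have := F.map (K.d n (n + 1)) ≫= hs
    rwa [comp_add, ← assoc (F.map _) (F.map _), ← F.map_comp, K.d_comp_d, F.map_zero, zero_comp,
      add_zero, comp_id] at this
  -- the splitting in degree `n + 1` gives a projection of `F Kⁿ` onto its cycles
  obtain ⟨p, hp⟩ : ∃ p : F.obj (K.X n) ⟶ F.obj (kernel (K.d n (n + 1))),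
      p ≫ F.map (kernel.ι (K.d n (n + 1))) = 𝟙 _ - F.map (K.d n (n + 1)) ≫ s := by
    let S : ShortComplex A := ShortComplex.mk (kernel.ι (K.d n (n + 1))) (K.d n (n + 1))
      (kernel.condition _)
    have hk : IsLimit ((KernelFork.ofι _ (kernel.condition (K.d n (n + 1)))).map F) :=
      KernelFork.mapIsLimit _ (kernelIsKernel _) F
    obtain ⟨p, hp⟩ := KernelFork.IsLimit.lift' hk (𝟙 _ - F.map (K.d n (n + 1)) ≫ s) (by
      rw [sub_comp, id_comp, assoc, hd, sub_self])
    exact ⟨p, hp⟩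
  let φ := cyclesCover adj K n
  refine (isSplitExactAt_iff _ (n - 1) n (n + 1) (by lia) rfl).2
    ⟨F.map ((mappingCone.snd φ).v n n (add_zero n)) ≫ p ≫ σ ≫
      F.map ((mappingCone.inl φ).v n (n - 1) (by lia)),
    F.map ((mappingCone.snd φ).v (n + 1) (n + 1) (add_zero _)) ≫ s ≫
      F.map ((mappingCone.inr φ).f n), ?_⟩
  have h0 : IsZero (((HomologicalComplex.single A (ComplexShape.up ℤ) n).obj
      (L.obj (F.obj (kernel (K.d n (n + 1)))))).X (n + 1)) :=
    HomologicalComplex.isZero_single_obj_X _ _ _ _ (by lia)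
  have h1 := mappingCone.inl_v_d φ n (n - 1) (n + 1) (by lia) (by lia)
  rw [h0.eq_of_tgt (HomologicalComplex.d _ n (n + 1)) 0, zero_comp, sub_zero] at h1
  have h2 := mappingCone.d_snd_v φ n (n + 1) rfl
  rw [h0.eq_of_tgt ((mappingCone.fst φ).1.v n (n + 1) rfl) 0, zero_comp, zero_add] at h2
  have h3 := mappingCone.id_X φ n (n + 1) rfl
  rw [h0.eq_of_tgt ((mappingCone.fst φ).1.v n (n + 1) rfl) 0, zero_comp, zero_add] at h3
  change (F.map ((mappingCone.snd φ).v n n (add_zero n)) ≫ p ≫ σ ≫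
      F.map ((mappingCone.inl φ).v n (n - 1) (by lia))) ≫ F.map ((mappingCone φ).d (n - 1) n) +
    F.map ((mappingCone φ).d n (n + 1)) ≫
    F.map ((mappingCone.snd φ).v (n + 1) (n + 1) (add_zero _)) ≫ s ≫
      F.map ((mappingCone.inr φ).f n) = 𝟙 (F.obj ((mappingCone φ).X n))
  rw [← F.map_id, ← h3, ← F.map_comp_assoc (mappingCone φ |>.d n (n + 1)), h2]
  simp only [assoc]
  rw [← F.map_comp, h1, F.map_comp, F.map_comp, F.map_comp, reassoc_of% hσ, reassoc_of% hp]
  simp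

/-- If `F K` is split exact outside `[a, n + 1]`, the cone of `cyclesCover` is so outside
`[a, n]`. -/
lemma isSplitExactAt_mappingCone_of_lt_or_lt (K : CochainComplex A ℤ) (a n : ℤ) (han : a ≤ n)
    (hK : ∀ k, k < a ∨ n + 1 < k → IsSplitExactAt ((F.mapHomologicalComplex _).obj K) k)
    (k : ℤ) (hk : k < a ∨ n < k) :
    IsSplitExactAt ((F.mapHomologicalComplex _).obj
      (mappingCone (cyclesCover adj K (n + 1)))) k := by
  obtain rfl | hk' := eq_or_ne k (n + 1)
  · exact isSplitExactAt_mappingCone_cyclesCover adj K _ (hK _ (by lia))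
  · have h := IsSplitExactAt.mappingCone (n := k)
      ((F.mapHomologicalComplex (ComplexShape.up ℤ)).map (cyclesCover adj K (n + 1)))
      ⟨0, 0, (F.map_isZero (HomologicalComplex.isZero_single_obj_X _ _ _ _ (by lia))).eq_of_src
        _ _⟩ (hK k (by lia))
    have e := mappingCone.mapHomologicalComplexIso (cyclesCover adj K (n + 1)) F
    exact h.of_homotopy e.hom e.inv (Homotopy.ofEq e.hom_inv_id)

end ConeReduction

/-! ### Essential surjectivity and thickness -/

section Truncation

variable {A : Type u₁} [Category.{v₁} A] [Abelian A] {B : Type u₂} [Category.{v₂} B] [Abelian B]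
  {F : A ⥤ B} [F.Additive]

/-- A complex `K` such that `F K` is split exact outside degree zero is isomorphic in `D_F(A)`
to an object of `A` in degree zero. -/
lemma exists_iso_singleDF [PreservesFiniteLimits F] [PreservesFiniteColimits F]
    (K : CochainComplex A ℤ)
    (hK : ∀ k, k < 0 ∨ 0 < k → IsSplitExactAt ((F.mapHomologicalComplex _).obj K) k) :
    ∃ M : A, Nonempty ((DF.Q F).obj ((HomotopyCategory.quotient A _).obj K) ≅
      (singleDF F).obj M) := by
  have h₁ := trW_ιTruncLE K 0 (fun k hk => hK k (Or.inr hk))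
  have h₂ := trW_πTruncGE (K.truncLE 0) 0
    (fun k hk => (isSplitExactAt_iff_of_trW _ h₁ k).2 (hK k (Or.inl hk)))
  have : ((K.truncLE 0).truncGE 0).IsStrictlyLE 0 := by
    rw [CochainComplex.isStrictlyLE_iff]
    intro k hk
    have : IsIso (((K.truncLE 0).πTruncGE 0).f k) :=
      isIso_πTruncGE_f _ (ComplexShape.embeddingUpIntGE 0) (i := (k - 0).natAbs)
        (by simp only [ComplexShape.embeddingUpIntGE_f]; lia)
        (by rw [ComplexShape.boundaryGE_embeddingUpIntGE_iff]; lia)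
    exact ((K.truncLE 0).isZero_of_isStrictlyLE 0 k).of_iso
      (asIso (((K.truncLE 0).πTruncGE 0).f k)).symm
  obtain ⟨M, ⟨e⟩⟩ := ((K.truncLE 0).truncGE 0).exists_iso_single 0
  have i₁ := Localization.inverts (DF.Q F) (splitAcyclic F).trW _ h₁
  have i₂ := Localization.inverts (DF.Q F) (splitAcyclic F).trW _ h₂
  exact ⟨M, ⟨(@asIso _ _ _ _ _ i₁).symm ≪≫ @asIso _ _ _ _ _ i₂ ≪≫
    (DF.Q F).mapIso ((HomotopyCategory.quotient A _).mapIso e)⟩⟩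

end Truncation

section EssSurj

variable {A : Type u₁} [Category.{v₁} A] [Abelian A] {B : Type u₂} [Category.{v₂} B] [Abelian B]
  {L R : B ⥤ A} {F : A ⥤ B} [F.Additive] (t : Adjunction.Triple L F R)

/-- The objects of `D^b_F(A)` which are isomorphic to an object of `A` in the quotient by `K(P)`,
and which belong to `K(P)` if they vanish in this quotient. -/
def isStablySingle : ObjectProperty (DbF F) := fun X =>
  (∃ M : A, Nonempty ((KProj t).trW.Q.obj X ≅ (singleQ t).obj M)) ∧
    (IsZero ((KProj t).trW.Q.obj X) → KProj t X)

/-- Morphisms with cone in `K(P)` do not change the class of an object in the quotient, nor whether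
it belongs to `K(P)`. -/
lemma isStablySingle_of_trW {X Y : DbF F} (f : X ⟶ Y) (hf : (KProj t).trW f)
    (hY : isStablySingle t Y) : isStablySingle t X := by
  obtain ⟨⟨M, ⟨e⟩⟩, h⟩ := hY
  have := Localization.inverts (KProj t).trW.Q (KProj t).trW _ hf
  let i : (KProj t).trW.Q.obj X ≅ (KProj t).trW.Q.obj Y := @asIso _ _ _ _ _ this
  refine ⟨⟨M, ⟨i ≪≫ e⟩⟩, fun hX => ?_⟩
  obtain ⟨K, a, b, hT, hK⟩ := hf
  exact (KProj t).ext_of_isTriangulatedClosed₁ _ hT (h (hX.of_iso i.symm)) hK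

instance : (isStablySingle t).IsClosedUnderIsomorphisms where
  of_iso e h := isStablySingle_of_trW t e.inv ((KProj t).trW_of_isIso _) h

/-- The object of `D^b_F(A)` given by a complex. -/
abbrev DbF.of (K : CochainComplex A ℤ)
    (hK : boundedSplitAcyclic F ((HomotopyCategory.quotient A _).obj K)) : DbF F :=
  ⟨(DF.Q F).obj ((HomotopyCategory.quotient A _).obj K), ObjectProperty.prop_map_obj _ _ hK⟩

omit [F.Additive] in
lemma boundedProj_single {P : A} (hP : IsFProjective t P) (n : ℤ) :
    boundedProj L ((HomologicalComplex.single A (ComplexShape.up ℤ) n).obj P) := by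
  refine ⟨fun k => ?_, n, n, fun k hk => HomologicalComplex.isZero_single_obj_X _ _ _ _ (by lia)⟩
  by_cases hk : k = n
  · subst hk
    exact hP.of_retract L (Retract.ofIso (HomologicalComplex.singleObjXSelf _ _ _))
  · exact .of_isZero L (HomologicalComplex.isZero_single_obj_X _ _ _ _ hk)

/-- A complex is isomorphic, modulo `K(P)`, to the cone of any morphism to it from a bounded complex
of relative projectives. -/
lemma trW_inr_of_boundedProj {P K : CochainComplex A ℤ} (hP : boundedProj L P) (φ : P ⟶ K)
    (hK : boundedSplitAcyclic F ((HomotopyCategory.quotient A _).obj K))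
    (hC : boundedSplitAcyclic F ((HomotopyCategory.quotient A _).obj (mappingCone φ))) :
    (KProj t).trW (X := DbF.of K hK) (Y := DbF.of (mappingCone φ) hC) ((boundedDF F).homMk
      ((DF.Q F).map ((HomotopyCategory.quotient A _).map (mappingCone.inr φ)))) := by
  have := t.adj₁.left_adjoint_additive
  refine (ObjectProperty.trW_inverseImage_ι_iff (boundedDF F)
    ((homotopyProj L).map (DF.Q F)) _).2 ?_
  rw [inf_eq_right.2 homotopyProj_map_le]
  exact ObjectProperty.trW.mk _ (rot_of_distTriang _ ((DF.Q F).map_distinguished _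
    (HomotopyCategory.mappingCone_triangleh_distinguished φ)))
    ⟨_, (homotopyProj L).le_shift (1 : ℤ) _ (ObjectProperty.prop_map_obj _ _ hP),
      ⟨((DF.Q F).commShiftIso (1 : ℤ)).app _⟩⟩

/-- An object of `A` vanishing in the quotient is zero in the stable category, by faithfulness. -/
lemma isZero_singleQ_iff [F.Faithful] [IsFrobenius t] {M : A} :
    IsZero ((singleQ t).obj M) ↔ IsFProjective t M := by
  refine ⟨fun h => ?_, isZero_single_of_projective t⟩
  obtain ⟨P, hP, a, b, hab⟩ := stableRel_zero_of_map_eq_zero t (𝟙 M) (h.eq_of_src _ _)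
  exact hP.of_retract L ⟨a, b, by rw [hab, sub_zero]⟩

lemma isStablySingle_single [F.Faithful] [IsFrobenius t] (M : A) :
    isStablySingle t ((singleDbF F).obj M) :=
  ⟨⟨M, ⟨Iso.refl _⟩⟩, fun h => ObjectProperty.prop_map_obj _ _ (ObjectProperty.prop_map_obj _ _
    (boundedProj_single t ((isZero_singleQ_iff t).1 h) 0))⟩

variable [F.Faithful] [IsFrobenius t]

/-- The shift of an object of `A` is isomorphic to its cosyzygy in the quotient. -/
lemma isStablySingle_shift {X : DbF F} (hX : isStablySingle t X) :
    isStablySingle t (X⟦(1 : ℤ)⟧) := by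
  obtain ⟨⟨M, ⟨e⟩⟩, h⟩ := hX
  let i : (KProj t).trW.Q.obj (X⟦(1 : ℤ)⟧) ≅ ((KProj t).trW.Q.obj X)⟦(1 : ℤ)⟧ :=
    ((KProj t).trW.Q.commShiftIso (1 : ℤ)).app X
  refine ⟨⟨(cosyzygy t).obj M, ⟨i ≪≫ (shiftFunctor _ (1 : ℤ)).mapIso e ≪≫
    ((cosyzygySingleQIso t).app M).symm⟩⟩, fun hX => (KProj t).le_shift (1 : ℤ) _ (h ?_)⟩
  refine IsZero.of_iso ?_ ((shiftFunctorCompIsoId _ (1 : ℤ) (-1) (by lia)).symm.app _)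
  exact (shiftFunctor _ (-1 : ℤ)).map_isZero (hX.of_iso i.symm)

/-- Induction on the number of degrees in which `F K` is not split exact, the highest of which is
removed by `cyclesCover`. -/
lemma isStablySingle_of_isSplitExactAt (n : ℕ) : ∀ (K : CochainComplex A ℤ)
    (hK : boundedSplitAcyclic F ((HomotopyCategory.quotient A _).obj K))
    (_ : ∀ k : ℤ, k < 0 ∨ n < k → IsSplitExactAt ((F.mapHomologicalComplex _).obj K) k),
    isStablySingle t (DbF.of K hK) := by
  have := preservesFiniteLimits_of_triple t
  have := preservesFiniteColimits_of_triple t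
  induction n with
  | zero =>
    intro K hK h
    obtain ⟨M, ⟨e⟩⟩ := exists_iso_singleDF K h
    let e' : DbF.of K hK ≅ (singleDbF F).obj M := (boundedDF F).isoMk e
    exact (isStablySingle t).prop_of_iso e'.symm (isStablySingle_single t M)
  | succ n ih =>
    intro K hK h
    have hC := isSplitExactAt_mappingCone_of_lt_or_lt t.adj₁ K 0 n (by lia) h
    exact isStablySingle_of_trW t _ (trW_inr_of_boundedProj t (boundedProj_single t
      ⟨_, ⟨Retract.refl _⟩⟩ _) (cyclesCover t.adj₁ K (n + 1)) hK ⟨0, n, hC⟩) (ih _ _ hC)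

lemma isStablySingle_shift_natCast {X : DbF F} (hX : isStablySingle t X) (n : ℕ) :
    isStablySingle t (X⟦(n : ℤ)⟧) := by
  induction n with
  | zero => exact (isStablySingle t).prop_of_iso ((shiftFunctorZero (DbF F) ℤ).symm.app X) hX
  | succ n ih =>
    exact (isStablySingle t).prop_of_iso
      ((CategoryTheory.shiftFunctorAdd' (DbF F) (n : ℤ) 1 _ (by simp)).symm.app X)
      (isStablySingle_shift t ih)

omit [F.Faithful] in
/-- The shift of a complex, as an object of `D^b_F(A)`. -/
lemma nonempty_iso_of_shift (K : CochainComplex A ℤ) (a : ℤ)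
    (hK : boundedSplitAcyclic F ((HomotopyCategory.quotient A _).obj K))
    (hK' : boundedSplitAcyclic F ((HomotopyCategory.quotient A _).obj (K⟦a⟧))) :
    Nonempty (DbF.of (K⟦a⟧) hK' ≅ (DbF.of K hK)⟦a⟧) := by
  let e : (DF.Q F).obj ((HomotopyCategory.quotient A _).obj (K⟦a⟧)) ≅
      ((DF.Q F).obj ((HomotopyCategory.quotient A _).obj K))⟦a⟧ :=
    (DF.Q F).mapIso (((HomotopyCategory.quotient A (.up ℤ)).commShiftIso a).app K) ≪≫
      ((DF.Q F).commShiftIso a).app _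
  exact ⟨(boundedDF F).isoMk (e ≪≫ (((boundedDF F).ι.commShiftIso a).app (DbF.of K hK)).symm)⟩

omit [F.Faithful] in
lemma isSplitExactAt_map_shift (K : CochainComplex A ℤ) (a n m : ℤ) (h : n + a = m)
    (hK : IsSplitExactAt ((F.mapHomologicalComplex _).obj K) m) :
    IsSplitExactAt ((F.mapHomologicalComplex _).obj (K⟦a⟧)) n := by
  have e := ((F.mapHomologicalComplex (ComplexShape.up ℤ)).commShiftIso a).app K
  exact (hK.shift a n h).of_homotopy e.hom e.inv (Homotopy.ofEq e.hom_inv_id)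

lemma isStablySingle_all (X : DbF F) : isStablySingle t X := by
  obtain ⟨X, K, ⟨a, b, hK⟩, ⟨e⟩⟩ := X
  obtain ⟨K, rfl⟩ := HomotopyCategory.quotient_obj_surjective K
  let hK' : boundedSplitAcyclic F ((HomotopyCategory.quotient A _).obj K) := ⟨a, b, hK⟩
  -- after a shift, the complex is split exact in negative degrees
  obtain ⟨n, hn⟩ : ∃ n : ℕ, -(n : ℤ) ≤ a := ⟨(-a).toNat, by lia⟩
  have hY : ∀ k : ℤ, k < 0 ∨ (b + n).toNat < k →
      IsSplitExactAt ((F.mapHomologicalComplex _).obj (K⟦(-n : ℤ)⟧)) k :=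
    fun k hk => isSplitExactAt_map_shift K (-n) k _ rfl (hK _ (by lia))
  have hY' : boundedSplitAcyclic F ((HomotopyCategory.quotient A _).obj (K⟦(-n : ℤ)⟧)) :=
    ⟨0, _, hY⟩
  have h := isStablySingle_shift_natCast t (isStablySingle_of_isSplitExactAt t _ _ hY' hY) n
  obtain ⟨i⟩ := nonempty_iso_of_shift K (-n : ℤ) hK' hY'
  let e' : DbF.of K hK' ≅ ⟨X, _, ⟨a, b, hK⟩, ⟨e⟩⟩ := (boundedDF F).isoMk e
  exact (isStablySingle t).prop_of_iso ((shiftFunctor (DbF F) (n : ℤ)).mapIso i ≪≫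
    (shiftFunctorCompIsoId (DbF F) (-n : ℤ) n (by lia)).app _ ≪≫ e') h

instance : (comparison t).EssSurj where
  mem_essImage X := by
    obtain ⟨Y, ⟨e⟩⟩ : ∃ Y, Nonempty ((KProj t).trW.Q.obj Y ≅ X) :=
      ⟨_, ⟨(KProj t).trW.Q.objObjPreimageIso X⟩⟩
    obtain ⟨M, ⟨e'⟩⟩ := (isStablySingle_all t Y).1
    exact ⟨(Stable.proj t).obj M, ⟨e'.symm ≪≫ e⟩⟩

instance : (comparison t).IsEquivalence where

/-- The objects of `K(P)` are those which vanish in the quotient. -/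
lemma isZero_Q_obj_iff (X : DbF F) : IsZero ((KProj t).trW.Q.obj X) ↔ KProj t X :=
  ⟨(isStablySingle_all t X).2, isZero_Q_obj⟩

instance : (KProj t).IsStableUnderRetracts where
  of_retract {X Y} r hY := by
    rw [← isZero_Q_obj_iff, IsZero.iff_id_eq_zero] at hY ⊢
    rw [← CategoryTheory.Functor.map_id, ← r.retract, Functor.map_comp,
      ← comp_id ((KProj t).trW.Q.map r.i), hY, comp_zero, zero_comp]

end EssSurj

/-! ### Transport of a triangulated structure along an equivalence -/

section Transport

variable {C : Type*} [Category* C] {D : Type*} [Category* D] [HasShift D ℤ]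

section

variable (G : C ⥤ D) [G.IsEquivalence]

/-- The compatibility of a functor which is an equivalence with the shift functors transported
along it. -/
def transportShiftIso (n : ℤ) :
    (G ⋙ shiftFunctor D n ⋙ G.inv) ⋙ G ≅ G ⋙ shiftFunctor D n :=
  Functor.associator _ _ _ ≪≫ Functor.isoWhiskerLeft G (Functor.associator _ _ _ ≪≫
    Functor.isoWhiskerLeft _ G.asEquivalence.counitIso ≪≫ Functor.rightUnitor _)

/-- The shift on a category transported along an equivalence. -/
abbrev transportShift : HasShift C ℤ :=
  (Functor.FullyFaithful.ofFullyFaithful G).hasShift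
    (fun n => G ⋙ shiftFunctor D n ⋙ G.inv) (transportShiftIso G)

/-- The equivalence commutes with the transported shift. -/
abbrev transportCommShift : letI := transportShift G; G.CommShift ℤ :=
  Functor.CommShift.ofHasShiftOfFullyFaithful _ _ _

end

variable [HasShift C ℤ] [Preadditive C] [Preadditive D] (G : C ⥤ D) [G.CommShift ℤ]
  [∀ n : ℤ, (shiftFunctor D n).Additive]

lemma shiftFunctor_additive_of_faithful [G.Additive] [G.Faithful] (n : ℤ) :
    (shiftFunctor C n).Additive where
  map_add {X Y f g} := by
    refine G.map_injective ((cancel_mono ((G.commShiftIso n).hom.app Y)).1 ?_)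
    rw [G.map_add, add_comp]
    have h (f : X ⟶ Y) := G.commShiftIso_hom_naturality f n
    refine (h _).trans (Eq.trans ?_ (congr_arg₂ (· + ·) (h f) (h g)).symm)
    rw [Functor.map_add, Functor.map_add, comp_add]

variable [HasZeroObject C] [HasZeroObject D] [∀ n : ℤ, (shiftFunctor C n).Additive]
  [Pretriangulated D]

/-- The pretriangulated structure transported along an equivalence which commutes with the
shift: a triangle is distinguished if its image is. -/
abbrev transportPretriangulated [G.Additive] [G.IsEquivalence] : Pretriangulated C where
  distinguishedTriangles := G.mapTriangle.obj ⁻¹' (distTriang D)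
  isomorphic_distinguished T₁ hT₁ T₂ e :=
    isomorphic_distinguished _ hT₁ _ (G.mapTriangle.mapIso e)
  contractible_distinguished X :=
    isomorphic_distinguished _ (contractible_distinguished (G.obj X)) _
      (Triangle.isoMk _ _ (Iso.refl _) (Iso.refl _) G.mapZeroObject
        ((comp_id _).trans ((G.map_id X).trans (id_comp _).symm))
        ((isZero_zero D).eq_of_tgt _ _) ((G.map_isZero (isZero_zero C)).eq_of_src _ _))
  distinguished_cocone_triangle {X Y} f := by
    obtain ⟨Z, g, h, mem⟩ := distinguished_cocone_triangle (G.map f)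
    refine ⟨G.objPreimage Z, G.preimage (g ≫ (G.objObjPreimageIso Z).inv),
      G.preimage ((G.objObjPreimageIso Z).hom ≫ h ≫ (G.commShiftIso (1 : ℤ)).inv.app X),
      isomorphic_distinguished _ mem _ (Triangle.isoMk _ _ (Iso.refl _) (Iso.refl _)
        (G.objObjPreimageIso Z) ?_ ?_ ?_)⟩
    · exact (comp_id _).trans (id_comp _).symm
    · refine Eq.trans ?_ (id_comp g).symm
      change G.map (G.preimage (g ≫ (G.objObjPreimageIso Z).inv)) ≫ (G.objObjPreimageIso Z).hom = g
      rw [G.map_preimage, assoc, Iso.inv_hom_id, comp_id]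
    · refine (congr_arg _ ((shiftFunctor D (1 : ℤ)).map_id _)).trans ((comp_id _).trans ?_)
      change G.map (G.preimage ((G.objObjPreimageIso Z).hom ≫ h ≫
        (G.commShiftIso (1 : ℤ)).inv.app X)) ≫ (G.commShiftIso (1 : ℤ)).hom.app X =
        (G.objObjPreimageIso Z).hom ≫ h
      rw [G.map_preimage, assoc, assoc, Iso.inv_hom_id_app]
      exact congr_arg _ (comp_id h)
  rotate_distinguished_triangle T :=
    (rotate_distinguished_triangle (G.mapTriangle.obj T)).trans
      (distinguished_iff_of_iso (G.mapTriangleRotateIso.app T))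
  complete_distinguished_triangle_morphism T₁ T₂ hT₁ hT₂ a b comm := by
    obtain ⟨c, ⟨hc₁, hc₂⟩⟩ := complete_distinguished_triangle_morphism (G.mapTriangle.obj T₁)
      (G.mapTriangle.obj T₂) hT₁ hT₂ (G.map a) (G.map b)
      ((G.map_comp _ _).symm.trans ((G.congr_map comm).trans (G.map_comp _ _)))
    obtain ⟨c, rfl⟩ : ∃ c', G.map c' = c := G.map_surjective c
    refine ⟨c, G.map_injective ?_, G.map_injective ?_⟩
    · exact (G.map_comp _ _).trans (hc₁.trans (G.map_comp _ _).symm)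
    · refine (cancel_mono ((G.commShiftIso (1 : ℤ)).hom.app T₂.obj₁)).1 ?_
      have h₁ : (G.map T₁.mor₃ ≫ (G.commShiftIso (1 : ℤ)).hom.app T₁.obj₁) ≫ (G.map a)⟦(1 : ℤ)⟧' =
        G.map c ≫ G.map T₂.mor₃ ≫ (G.commShiftIso (1 : ℤ)).hom.app T₂.obj₁ := hc₂
      have h₂ := G.commShiftIso_hom_naturality a (1 : ℤ)
      rw [assoc, ← h₂] at h₁
      rw [G.map_comp, G.map_comp, assoc, assoc]
      exact h₁

end Transport

/-! ### The triangulation of the stable category -/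

section StableTriangles

variable {A : Type u₁} [Category.{v₁} A] [Abelian A] {B : Type u₂} [Category.{v₂} B] [Abelian B]
  {L R : B ⥤ A} {F : A ⥤ B} [F.Additive] [F.Faithful] (t : Adjunction.Triple L F R)

/-- Every morphism `f : X ⟶ Y` of `A` is, up to the relatively projective summand `R F X` of the
target, the first morphism of a standard triangle. -/
def standardTriangleOfHom {X Y : A} (f : X ⟶ Y) : StandardTriangle t where
  S := ShortComplex.mk (biprod.lift f (t.adj₂.unit.app X)) (cokernel.π _) (cokernel.condition _)
  shortExact := ShortComplex.ShortExact.mk' (ShortComplex.exact_cokernel _)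
    (mono_of_mono_fac (biprod.lift_snd f (t.adj₂.unit.app X)))
    (inferInstanceAs (Epi (cokernel.π _)))
  split := by
    have := preservesFiniteLimits_of_triple t
    have := preservesFiniteColimits_of_triple t
    refine nonempty_splitting_of_retraction (ShortComplex.ShortExact.mk'
      (ShortComplex.exact_cokernel _) (mono_of_mono_fac (biprod.lift_snd f (t.adj₂.unit.app X)))
      (inferInstanceAs (Epi (cokernel.π _))))
      (F.map biprod.snd ≫ t.adj₂.counit.app (F.obj X)) ?_
    change F.map (biprod.lift f (t.adj₂.unit.app X)) ≫ F.map biprod.snd ≫ _ = _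
    rw [← F.map_comp_assoc, biprod.lift_snd]
    exact t.adj₂.left_triangle_components X
  h := biprod.snd
  f_h := biprod.lift_snd _ _
  w := cokernel.desc _ (biprod.snd ≫ cokernel.π (t.adj₂.unit.app X))
    ((biprod.lift_snd_assoc _ _ _).trans (cokernel.condition _))
  g_w := cokernel.π_desc _ _ _

variable [IsFrobenius t]

omit [Abelian B] [F.Additive] [F.Faithful] in
/-- Adding a relatively injective summand does not change an object of the stable category. -/
lemma isIso_proj_fst (Y : A) (Z : B) :
    IsIso ((Stable.proj t).map (biprod.fst : Y ⊞ R.obj Z ⟶ Y)) := by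
  refine ⟨(Stable.proj t).map biprod.inl, ?_, ?_⟩
  · rw [← Functor.map_comp, ← CategoryTheory.Functor.map_id]
    refine (CategoryTheory.Quotient.sound _
      ⟨_, isFProjective_obj t Z, biprod.snd, biprod.inr, ?_⟩).symm
    rw [← biprod.total]
    abel
  · rw [← Functor.map_comp, biprod.inl_fst, CategoryTheory.Functor.map_id]

instance : (comparison t).Additive where
  map_add {X Y f g} := by
    obtain ⟨f, rfl⟩ := (Stable.proj t).map_surjective f
    obtain ⟨g, rfl⟩ := (Stable.proj t).map_surjective g
    rw [← (Stable.proj t).map_add]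
    exact (singleQ t).map_add

variable [HasShift (Stable t) ℤ] [(comparison t).CommShift ℤ]

/-- If the comparison functor commutes with the shift, the shift of the stable category is the
suspension. -/
def shiftIsoSusp : shiftFunctor (Stable t) (1 : ℤ) ≅ Stable.susp t :=
  ((Functor.FullyFaithful.ofFullyFaithful (comparison t)).whiskeringRight (Stable t)).preimageIso
    ((comparison t).commShiftIso (1 : ℤ) ≪≫ (suspComparisonIso t).symm)

lemma comparison_map_shiftIsoSusp_hom_app (X : Stable t) :
    (comparison t).map ((shiftIsoSusp t).hom.app X) =
      ((comparison t).commShiftIso (1 : ℤ)).hom.app X ≫ (suspComparisonIso t).inv.app X :=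
  NatTrans.congr_app (((Functor.FullyFaithful.ofFullyFaithful (comparison t)).whiskeringRight
    (Stable t)).map_preimage ((comparison t).commShiftIso (1 : ℤ) ≪≫
      (suspComparisonIso t).symm).hom) X

lemma comparison_map_shiftIsoSusp_inv_app (X : Stable t) :
    (comparison t).map ((shiftIsoSusp t).inv.app X) ≫
      ((comparison t).commShiftIso (1 : ℤ)).hom.app X = (suspComparisonIso t).hom.app X := by
  have h := comparison_map_shiftIsoSusp_hom_app t X
  have h' : ((comparison t).commShiftIso (1 : ℤ)).hom.app X =
      (comparison t).map ((shiftIsoSusp t).hom.app X) ≫ (suspComparisonIso t).hom.app X := by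
    rw [h, assoc, Iso.inv_hom_id_app]
    exact (comp_id _).symm
  rw [h', ← Functor.map_comp_assoc, Iso.inv_hom_id_app, CategoryTheory.Functor.map_id]
  exact id_comp _

/-- A standard triangle, as a triangle in the stable category. -/
abbrev StandardTriangle.triangle (E : StandardTriangle t) : Triangle (Stable t) :=
  Triangle.mk ((Stable.proj t).map E.S.f) ((Stable.proj t).map E.S.g)
    ((Stable.proj t).map E.w ≫ (shiftIsoSusp t).inv.app ((Stable.proj t).obj E.S.X₁))

variable [∀ n : ℤ, (shiftFunctor (Stable t) n).Additive] [Pretriangulated (Stable t)]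
  [(comparison t).IsTriangulated]

/-- The comparison functor maps a standard triangle to the distinguished triangle of the connecting
morphism of its short exact sequence. -/
lemma StandardTriangle.triangle_distinguished (E : StandardTriangle t) :
    E.triangle t ∈ distTriang (Stable t) := by
  rw [← (comparison t).map_distinguished_iff]
  refine isomorphic_distinguished _ (quotientδ_distinguished t E.S E.split) _ ?_
  refine Triangle.isoMk _ _ (Iso.refl _) (Iso.refl _) (Iso.refl _) ?_ ?_ ?_
  · exact (comp_id _).trans (id_comp _).symm
  · exact (comp_id _).trans (id_comp _).symm
  · refine (congr_arg _ ((shiftFunctor _ (1 : ℤ)).map_id _)).trans ((comp_id _).trans ?_)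
    refine Eq.trans ?_ (id_comp _).symm
    refine Eq.trans ?_ (quotientδ_standardTriangle t E).symm
    refine (congr_arg (· ≫ _) ((comparison t).map_comp _ _)).trans ((assoc _ _ _).trans ?_)
    exact congr_arg _ (comparison_map_shiftIsoSusp_inv_app t _)

/-- The first morphism of a distinguished triangle is isomorphic in the stable category to the first
morphism of a standard triangle, so that the triangles are isomorphic as well. -/
lemma distinguished_iff_nonempty_iso (T : Triangle (Stable t)) :
    T ∈ distTriang (Stable t) ↔ ∃ E : StandardTriangle t, Nonempty (T ≅ E.triangle t) := by
  refine ⟨fun hT => ?_, fun ⟨E, ⟨e⟩⟩ => isomorphic_distinguished _ (E.triangle_distinguished t) _ e⟩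
  obtain ⟨⟨X⟩, ⟨Y⟩, Z, f, g, h⟩ := T
  obtain ⟨f, rfl⟩ := (Stable.proj t).map_surjective f
  let e : (Stable.proj t).obj (Y ⊞ R.obj (F.obj X)) ≅ (Stable.proj t).obj Y :=
    @asIso _ _ _ _ _ (isIso_proj_fst t Y (F.obj X))
  refine ⟨standardTriangleOfHom t f, ⟨(isoTriangleOfIso₁₂ _ _
    ((standardTriangleOfHom t f).triangle_distinguished t) hT (Iso.refl _) e ?_).symm⟩⟩
  refine Eq.trans ?_ (id_comp _).symm
  refine ((Stable.proj t).map_comp _ _).symm.trans ?_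
  exact congr_arg _ (biprod.lift_fst _ _)

/-- `distinguished_iff_nonempty_iso` in terms of components, the third morphism being considered as
a morphism to the cosyzygy. -/
lemma distinguished_iff_standard (T : Triangle (Stable t)) :
    T ∈ distTriang (Stable t) ↔ ∃ (E : StandardTriangle t)
      (e₁ : T.obj₁ ≅ (Stable.proj t).obj E.S.X₁)
      (e₂ : T.obj₂ ≅ (Stable.proj t).obj E.S.X₂)
      (e₃ : T.obj₃ ≅ (Stable.proj t).obj E.S.X₃),
      T.mor₁ ≫ e₂.hom = e₁.hom ≫ (Stable.proj t).map E.S.f ∧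
      T.mor₂ ≫ e₃.hom = e₂.hom ≫ (Stable.proj t).map E.S.g ∧
      T.mor₃ ≫ e₁.hom⟦(1 : ℤ)⟧' ≫ (shiftIsoSusp t).hom.app ((Stable.proj t).obj E.S.X₁) =
        (e₃.hom ≫ (Stable.proj t).map E.w : _ ⟶ (Stable.proj t).obj ((cosyzygy t).obj E.S.X₁)) := by
  rw [distinguished_iff_nonempty_iso]
  refine exists_congr (fun E => ⟨fun ⟨e⟩ => ?_, fun ⟨e₁, e₂, e₃, h₁, h₂, h₃⟩ => ?_⟩)
  · refine ⟨Triangle.π₁.mapIso e, Triangle.π₂.mapIso e, Triangle.π₃.mapIso e, e.hom.comm₁,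
      e.hom.comm₂, ?_⟩
    have h := e.hom.comm₃
    refine (assoc _ _ _).symm.trans ((congr_arg (· ≫ _) h).trans ((assoc _ _ _).trans ?_))
    refine congr_arg _ ((assoc _ _ _).trans ?_)
    exact (congr_arg _ (Iso.inv_hom_id_app _ _)).trans (comp_id _)
  · refine ⟨Triangle.isoMk _ _ e₁ e₂ e₃ h₁ h₂ ?_⟩
    refine (cancel_mono ((shiftIsoSusp t).hom.app ((Stable.proj t).obj E.S.X₁))).1 ?_
    refine (assoc _ _ _).trans (h₃.trans (Eq.trans ?_ (assoc _ _ _).symm))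
    refine congr_arg _ (Eq.trans ?_ (assoc _ _ _).symm)
    exact ((congr_arg (fun f => ((Stable.proj t).map E.w : _ ⟶ (Stable.susp t).obj
      ((Stable.proj t).obj E.S.X₁)) ≫ f) (Iso.inv_hom_id_app (shiftIsoSusp t)
        ((Stable.proj t).obj E.S.X₁))).trans (comp_id _)).symm

end StableTriangles

end RelativeStable

end

theorem mainTheorem1 {A : Type u₁} [Category.{v₁} A] [Abelian A]
    {B : Type u₂} [Category.{v₂} B] [Abelian B]
    {F : A ⥤ B} [F.Additive] [F.Faithful] {L R : B ⥤ A} (t : Adjunction.Triple L F R)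
    [RelativeStable.IsFrobenius t] :
    (RelativeStable.KProj t).IsStableUnderRetracts ∧
    ∃ τ : RelativeStable.StableTriangulation t,
      letI := τ.shift
      letI := τ.additive_shift
      letI := τ.pretriangulated
      ∃ _ : (RelativeStable.comparison t).CommShift ℤ,
        (RelativeStable.comparison t).IsTriangulated ∧
        (RelativeStable.comparison t).IsEquivalence := by
  refine ⟨inferInstance, ?_⟩
  let G := RelativeStable.comparison t
  let i₁ : HasShift (RelativeStable.Stable t) ℤ := RelativeStable.transportShift G
  let i₂ : G.CommShift ℤ := RelativeStable.transportCommShift G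
  let i₃ : ∀ n : ℤ, (shiftFunctor (RelativeStable.Stable t) n).Additive :=
    RelativeStable.shiftFunctor_additive_of_faithful G
  let i₄ : Pretriangulated (RelativeStable.Stable t) := RelativeStable.transportPretriangulated G
  have i₅ : G.IsTriangulated := ⟨fun _ hT => hT⟩
  exact ⟨{
    shift := i₁
    additive_shift := i₃
    pretriangulated := i₄
    isTriangulated := IsTriangulated.of_fully_faithful_triangulated_functor G
    suspIso := RelativeStable.shiftIsoSusp t
    distinguished_iff := RelativeStable.distinguished_iff_standard t }, i₂, i₅, inferInstance⟩
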